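/- Let $n\ge 3$, $1<p<\infty$, $1<q'<\infty$, and let $p'$ and $q$ be the conjugate exponents, $\frac1p+\frac1{p'}=1$, $\frac1q+\frac1{q'}=1$. Let $\alpha,\beta,\gamma\in\mathbb R$ satisfy $$\frac{n-1}{n}\frac1p+\frac1{q'}\ge 1,\qquad 2\le\gamma<n,\qquad \alpha<\frac{n-1}{p'},\qquad \beta<\frac nq+1,\qquad \alpha+\beta\ge 0,$$ $$\frac{n-1}{n}\frac1p+\frac1{q'}+\frac{\alpha+\beta+2-\gamma}{n}=1.$$ Let $\mathbb R^n_+=\{x=(x',x_n)\in\mathbb R^{n-1}\times\mathbb R: x_n>0\}$ and $\partial\mathbb R^n_+=\mathbb R^{n-1}$, both with Lebesgue measure, let $$P(x,\xi,\gamma)=\frac{x_n}{(|x'-\xi|^2+x_n^2)^{\frac{n+2-\gamma}{2}}},\qquad V(f)(x)=\int_{\partial\mathbb R^n_+}|\xi|^{-\alpha}P(x,\xi,\gamma)f(\xi)|x|^{-\beta}\,d\xi,$$ and for measurable $f:\partial\mathbb R^n_+\to\mathbb R$ let $$\|f\|_{L^{p,q}(\partial\mathbb R^n_+)}=\Big(\int_0^\infty\big(t^{1/p}f^*(t)\big)^q\frac{dt}{t}\Big)^{1/q},\qquad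 f^*(t)=\inf\{s\ge 0: |\{\xi:|f(\xi)|>s\}|\le t\}.$$ Then there is a constant $C=C_{n,\alpha,\beta,p,q'}>0$ such that for every measurable $f$ on $\partial\mathbb R^n_+$ with $\|f\|_{L^{p,q}(\partial\mathbb R^n_+)}<\infty$ the integral defining $V(f)(x)$ converges absolutely for almost every $x\in\mathbb R^n_+$, $V(f)\in L^q(\mathbb R^n_+)$, and $$\|V(f)\|_{L^q(\mathbb R^n_+)}\le C\,\|f\|_{L^{p,q}(\partial\mathbb R^n_+)}.$$ -/

import Mathlib

open MeasureTheory
open scoped ENNReal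

noncomputable section

namespace SteinWeissPoisson

/-- The boundary `∂ℝⁿ₊ = ℝⁿ⁻¹` with its Euclidean norm and Lebesgue measure. -/
abbrev Boundary (n : ℕ) : Type := EuclideanSpace ℝ (Fin (n - 1))

/-- The ambient space `ℝⁿ = ℝⁿ⁻¹ × ℝ`, with points `x = (x', xₙ)`. Its `volume` is the product
measure, that is, Lebesgue measure. The product norm of Mathlib is the sup norm, hence it is
not used; the Euclidean norm is `euclNorm`. -/
abbrev Ambient (n : ℕ) : Type := Boundary n × ℝ

/-- The Euclidean norm `|x| = (|x'|² + xₙ²)^(1/2)` of `x = (x', xₙ)`. -/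
def euclNorm {n : ℕ} (x : Ambient n) : ℝ := Real.sqrt (‖x.1‖ ^ 2 + x.2 ^ 2)

/-- The open upper half space `ℝⁿ₊ = {(x', xₙ) : xₙ > 0}`. -/
def halfSpace (n : ℕ) : Set (Ambient n) := {x | 0 < x.2}

/-- The fractional Poisson kernel `P(x, ξ, γ) = xₙ / (|x' - ξ|² + xₙ²)^((n + 2 - γ) / 2)`. -/
def poissonKernel {n : ℕ} (γ : ℝ) (x : Ambient n) (ξ : Boundary n) : ℝ :=
  x.2 / (‖x.1 - ξ‖ ^ 2 + x.2 ^ 2) ^ (((n : ℝ) + 2 - γ) / 2)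

/-- The integrand `|ξ|^(-α) P(x, ξ, γ) f(ξ) |x|^(-β)` of the double weighted operator. -/
def weightedIntegrand {n : ℕ} (α β γ : ℝ) (f : Boundary n → ℝ) (x : Ambient n)
    (ξ : Boundary n) : ℝ :=
  ‖ξ‖ ^ (-α) * poissonKernel γ x ξ * f ξ * euclNorm x ^ (-β)

/-- The double weighted operator `V(f)(x) = ∫ |ξ|^(-α) P(x, ξ, γ) f(ξ) |x|^(-β) dξ`. -/
def V {n : ℕ} (α β γ : ℝ) (f : Boundary n → ℝ) (x : Ambient n) : ℝ :=
  ∫ ξ, weightedIntegrand α β γ f x ξ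

/-- The decreasing rearrangement `f*(t) = inf {s ≥ 0 : |{ξ : |f(ξ)| > s}| ≤ t}`, with values
in `[0, ∞]`. -/
def decreasingRearrangement {n : ℕ} (f : Boundary n → ℝ) (t : ℝ) : ℝ≥0∞ :=
  sInf {s : ℝ≥0∞ | volume {ξ | s < ‖f ξ‖ₑ} ≤ ENNReal.ofReal t}

/-- The Lorentz (quasi-)norm `(∫₀^∞ (t^(1/r) f*(t))^s dt/t)^(1/s)` on `∂ℝⁿ₊`, with values in
`[0, ∞]`, for finite indices `r, s > 0`. -/
def lorentzNorm {n : ℕ} (r s : ℝ) (f : Boundary n → ℝ) : ℝ≥0∞ :=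
  (∫⁻ t in Set.Ioi (0 : ℝ),
    (ENNReal.ofReal (t ^ (1 / r)) * decreasingRearrangement f t) ^ s / ENNReal.ofReal t) ^ (1 / s)

end SteinWeissPoisson

end

namespace SteinWeissPoisson

open Set Filter Topology

/-! ### Layer cake formulas in `[0, ∞]` -/

/-! Write m = n - 1, a = 1/p, b = 1/q and σ = m a - n b. With K the positive kernel of the operator,
the core is the restricted estimate ∫_F ∫_E K ≤ C |E|^a |F|^(1-b), with E in the boundary and F in
the half space (`exists_lintegral_weightedKernel_le`). The hypotheses say that σ ≥ 0, that
homogeneity balances, and that α, β satisfy strict bounds in terms of a, b. Moving (a, b) by ±(δ, η)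
with m δ = n η leaves σ and the balance unchanged, and a small move keeps the strict bounds. So the
restricted estimate holds at two points on either side of (1/p, 1/q), and real interpolation
upgrades it to a bound from L^{p,q} to L^q (`lintegral_kernel_rpow_le`).

The restricted estimate comes from three regions (`ofReal_supKernel_le`). If |ξ| is small against
|x|, or |x| against |ξ|, the kernel is at most a product of powers of |x| and |ξ|. Hölder then
bounds the integral over the smaller variable, and the integral of a power over a set of given
measure is largest, up to a constant, when the set is a ball about the singularity. If |x| and |ξ|
are comparable, α + β ≥ 0 absorbs the weights into x_n |x - ξ|^(-(n - σ)), and the estimate is a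
geometric mean of the bounds obtained by integrating in ξ alone and in x alone
(`exists_lintegral_boundaryKernel_le`).

For the interpolation, the layer cake formula turns the two restricted estimates into a bound for
averages of the image by a Calderón operator acting on f*. A Schur test bounds that operator. -/

theorem lintegral_Ioi_indicator_lt (a : ℝ≥0∞) :
    ∫⁻ s in Ioi (0 : ℝ), {s : ℝ | ENNReal.ofReal s < a}.indicator 1 s = a := by
  have hm : MeasurableSet {s : ℝ | ENNReal.ofReal s < a} :=
    measurableSet_lt ENNReal.measurable_ofReal measurable_const
  rw [lintegral_indicator_one hm, Measure.restrict_apply hm]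
  rcases eq_or_ne a ⊤ with rfl | ha
  · simp
  · have : {s : ℝ | ENNReal.ofReal s < a} ∩ Ioi 0 = Ioo 0 a.toReal := by
      ext s
      simp only [mem_inter_iff, mem_ofPred_eq, mem_Ioi, mem_Ioo]
      constructor
      · rintro ⟨h, hs⟩
        exact ⟨hs, (ENNReal.ofReal_lt_iff_lt_toReal hs.le ha).1 h⟩
      · rintro ⟨hs, h⟩
        exact ⟨(ENNReal.ofReal_lt_iff_lt_toReal hs.le ha).2 h, hs⟩
    rw [this, Real.volume_Ioo, sub_zero, ENNReal.ofReal_toReal ha]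

theorem volume_Ioi_inter_ofReal_le (a : ℝ≥0∞) :
    volume ({s : ℝ | ENNReal.ofReal s ≤ a} ∩ Ioi 0) ≤ a := by
  rcases eq_or_ne a ⊤ with rfl | ha
  · simp
  · have : {s : ℝ | ENNReal.ofReal s ≤ a} ∩ Ioi 0 ⊆ Ioc 0 a.toReal := by
      rintro s ⟨h, hs⟩
      exact ⟨hs, (ENNReal.ofReal_le_iff_le_toReal ha).1 h⟩
    refine (measure_mono this).trans ?_
    rw [Real.volume_Ioc, sub_zero, ENNReal.ofReal_toReal ha]

theorem lintegral_eq_lintegral_Ioi_meas_lt {Y : Type*} [MeasurableSpace Y] (ν : Measure Y)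
    [SFinite ν] {f : Y → ℝ≥0∞} (hf : Measurable f) :
    ∫⁻ y, f y ∂ν = ∫⁻ s in Ioi (0 : ℝ), ν {y | ENNReal.ofReal s < f y} := by
  have hm : MeasurableSet {z : Y × ℝ | ENNReal.ofReal z.2 < f z.1} :=
    measurableSet_lt (by fun_prop) (by fun_prop)
  calc ∫⁻ y, f y ∂ν
      = ∫⁻ y, (∫⁻ s in Ioi (0 : ℝ),
          {z : Y × ℝ | ENNReal.ofReal z.2 < f z.1}.indicator 1 (y, s)) ∂ν :=
        lintegral_congr fun y => (lintegral_Ioi_indicator_lt (f y)).symm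
    _ = ∫⁻ s in Ioi (0 : ℝ), ∫⁻ y,
          {z : Y × ℝ | ENNReal.ofReal z.2 < f z.1}.indicator 1 (y, s) ∂ν :=
        lintegral_lintegral_swap
          (f := fun y s => {z : Y × ℝ | ENNReal.ofReal z.2 < f z.1}.indicator 1 (y, s))
          (measurable_one.indicator hm).aemeasurable
    _ = _ := by
        refine lintegral_congr fun s => ?_
        exact lintegral_indicator_one (s := {y | ENNReal.ofReal s < f y})
          (measurableSet_lt measurable_const hf)

/-! ### Decreasing rearrangement -/

/-- The decreasing rearrangement of a `[0, ∞]`-valued function. -/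
noncomputable def rearrangement {Y : Type*} [MeasurableSpace Y] (ν : Measure Y) (f : Y → ℝ≥0∞) (t : ℝ) : ℝ≥0∞ :=
  sInf {s : ℝ≥0∞ | ν {y | s < f y} ≤ ENNReal.ofReal t}

section Rearrangement

variable {Y : Type*} [MeasurableSpace Y] {ν : Measure Y}

theorem antitone_rearrangement (f : Y → ℝ≥0∞) : Antitone (rearrangement ν f) := by
  intro t t' h
  exact sInf_le_sInf fun s hs => le_trans hs (ENNReal.ofReal_le_ofReal h)

theorem measurable_rearrangement (f : Y → ℝ≥0∞) : Measurable (rearrangement ν f) :=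
  (antitone_rearrangement f).measurable

theorem le_rearrangement_of_lt {f : Y → ℝ≥0∞} {r : ℝ} {s : ℝ≥0∞}
    (h : ENNReal.ofReal r < ν {y | s < f y}) : s ≤ rearrangement ν f r := by
  refine le_sInf fun s' hs' => ?_
  by_contra! hlt
  refine absurd (h.trans_le ((measure_mono ?_).trans hs')) (lt_irrefl _)
  exact fun y hy => hlt.trans hy

end Rearrangement

/-! ### The kernel of the Calderón operator -/

/-- `min (r^(a+δ) t^(-(b+η)), r^(a-δ) t^(-(b-η)))` -/
noncomputable def calderonKernel (a b δ η : ℝ) (t r : ℝ≥0∞) : ℝ≥0∞ :=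
  min (r ^ (a + δ) * t ^ (-(b + η))) (r ^ (a - δ) * t ^ (-(b - η)))

section Calderon

variable {a b δ η : ℝ}

theorem measurable_calderonKernel :
    Measurable fun z : ℝ≥0∞ × ℝ≥0∞ => calderonKernel a b δ η z.1 z.2 := by
  unfold calderonKernel
  fun_prop

theorem calderonKernel_antitone (hb : 0 ≤ b - η) (hη : 0 ≤ η) (r : ℝ≥0∞) :
    Antitone fun t => calderonKernel a b δ η t r := by
  intro t t' h
  have key : ∀ c : ℝ, 0 ≤ c → t' ^ (-c) ≤ t ^ (-c) := fun c hc => by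
    rw [ENNReal.rpow_neg, ENNReal.rpow_neg]
    exact ENNReal.inv_le_inv.2 (ENNReal.rpow_le_rpow h hc)
  exact min_le_min (mul_le_mul_right (key _ (by linarith)) _)
    (mul_le_mul_right (key _ (by linarith)) _)

/-- Both powers of r have exponent in [0, 1], so doubling r costs at most a factor 2. -/
theorem half_calderonKernel_le (ha : 0 ≤ a - δ) (hδ : 0 ≤ δ) (ha1 : a + δ ≤ 1) {t r r' : ℝ≥0∞}
    (hr : r ≤ 2 * r') :
    calderonKernel a b δ η t r ≤ 2 * calderonKernel a b δ η t r' := by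
  have key : ∀ c : ℝ, 0 ≤ c → c ≤ 1 → r ^ c ≤ 2 * r' ^ c := fun c hc hc1 => by
    calc r ^ c ≤ (2 * r') ^ c := ENNReal.rpow_le_rpow hr hc
      _ = 2 ^ c * r' ^ c := ENNReal.mul_rpow_of_nonneg _ _ hc
      _ ≤ 2 ^ (1 : ℝ) * r' ^ c := by
          gcongr
          exact one_le_two
      _ = _ := by rw [ENNReal.rpow_one]
  unfold calderonKernel
  rw [mul_min, ← mul_assoc, ← mul_assoc]
  exact min_le_min (mul_le_mul_left (key _ (by linarith) (by linarith)) _)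
    (mul_le_mul_left (key _ (by linarith) (by linarith)) _)

/-- On (l/2, l) the kernel is at least half its value at l and 1/r ≥ 1/l. As that interval has
length l/2, it alone contributes a quarter of the value. This replaces the fundamental theorem of
calculus for a kernel with a corner. -/
theorem calderonKernel_le_lintegral_of_ne_top (ha : 0 < a - δ) (hδ : 0 ≤ δ) (ha1 : a + δ ≤ 1)
    (t : ℝ≥0∞) {l : ℝ} (hl : 0 < l) :
    calderonKernel a b δ η t (ENNReal.ofReal l) ≤ 4 * ∫⁻ r in Ioi (0 : ℝ),
      {r : ℝ | ENNReal.ofReal r < ENNReal.ofReal l}.indicator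
        (fun r => calderonKernel a b δ η t (ENNReal.ofReal r) / ENNReal.ofReal r) r := by
  set k := calderonKernel a b δ η t (ENNReal.ofReal l)
  have h1 : ∫⁻ r in Ioo (l / 2) l, k / 2 / ENNReal.ofReal l ≤ ∫⁻ r in Ioi (0 : ℝ),
      {r : ℝ | ENNReal.ofReal r < ENNReal.ofReal l}.indicator
        (fun r => calderonKernel a b δ η t (ENNReal.ofReal r) / ENNReal.ofReal r) r := by
    refine le_trans ?_ (lintegral_mono_set (s := Ioo (l / 2) l) fun r hr =>
      lt_trans (by positivity) hr.1)
    refine setLIntegral_mono' measurableSet_Ioo fun r hr => ?_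
    have hmem : r ∈ {r : ℝ | ENNReal.ofReal r < ENNReal.ofReal l} :=
      (ENNReal.ofReal_lt_ofReal_iff hl).2 hr.2
    rw [indicator_of_mem hmem]
    refine ENNReal.div_le_div ?_ (le_of_lt hmem)
    rw [ENNReal.div_le_iff two_ne_zero ENNReal.ofNat_ne_top, mul_comm]
    refine half_calderonKernel_le ha.le hδ ha1 ?_
    rw [← ENNReal.ofReal_ofNat, ← ENNReal.ofReal_mul zero_le_two]
    exact ENNReal.ofReal_le_ofReal (by linarith [hr.1])
  rw [setLIntegral_const, Real.volume_Ioo] at h1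
  refine le_trans (le_of_eq ?_) (mul_le_mul_right h1 4)
  have h2 : ENNReal.ofReal (l - l / 2) = ENNReal.ofReal l / 2 := by
    rw [← ENNReal.ofReal_ofNat 2, ← ENNReal.ofReal_div_of_pos zero_lt_two]
    congr 1
    ring
  have hl0 : ENNReal.ofReal l ≠ 0 := by simpa using hl
  rw [h2, div_eq_mul_inv k, div_eq_mul_inv _ (ENNReal.ofReal l), div_eq_mul_inv _ (2 : ℝ≥0∞)]
  calc k = k * 1 * 1 := by simp
    _ = k * (4 * 2⁻¹ * 2⁻¹) * ((ENNReal.ofReal l)⁻¹ * ENNReal.ofReal l) := by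
        rw [ENNReal.inv_mul_cancel hl0 ENNReal.ofReal_ne_top]
        congr 2
        rw [show (4 : ℝ≥0∞) = 2 * 2 by norm_num, mul_assoc 2 2,
          ENNReal.mul_inv_cancel two_ne_zero ENNReal.ofNat_ne_top, mul_one,
          ENNReal.mul_inv_cancel two_ne_zero ENNReal.ofNat_ne_top]
    _ = _ := by ring

theorem calderonKernel_le_lintegral (ha : 0 < a - δ) (hδ : 0 ≤ δ) (ha1 : a + δ ≤ 1)
    {t : ℝ≥0∞} (ht : t ≠ 0) (ht' : t ≠ ⊤) (l : ℝ≥0∞) :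
    calderonKernel a b δ η t l ≤ 4 * ∫⁻ r in Ioi (0 : ℝ),
      {r : ℝ | ENNReal.ofReal r < l}.indicator
        (fun r => calderonKernel a b δ η t (ENNReal.ofReal r) / ENNReal.ofReal r) r := by
  rcases eq_or_ne l ⊤ with rfl | hl
  -- A level set may have infinite measure; that case is the limit of finite l.
  · have hcont : Continuous fun r : ℝ≥0∞ => calderonKernel a b δ η t r := by
      unfold calderonKernel
      refine Continuous.min ?_ ?_ <;>
      exact (ENNReal.continuous_mul_const (ENNReal.rpow_ne_top_of_ne_zero ht ht')).comp
        ENNReal.continuous_rpow_const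
    refine le_of_tendsto ((hcont.tendsto ⊤).comp ENNReal.tendsto_ofReal_atTop) ?_
    filter_upwards [eventually_gt_atTop 0] with r hr
    refine (calderonKernel_le_lintegral_of_ne_top ha hδ ha1 t hr).trans ?_
    refine mul_le_mul_right (lintegral_mono fun s => ?_) 4
    refine indicator_le_indicator_of_subset ?_ (fun _ => zero_le) s
    exact fun s hs => lt_top_iff_ne_top.2 ENNReal.ofReal_ne_top
  · lift l to NNReal using hl
    rcases eq_or_ne l 0 with rfl | hl0
    · simp [calderonKernel, ENNReal.zero_rpow_of_pos ha,
        ENNReal.zero_rpow_of_pos (show 0 < a + δ by linarith)]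
    · rw [← ENNReal.ofReal_coe_nnreal]
      exact calderonKernel_le_lintegral_of_ne_top ha hδ ha1 t (by positivity)

/-- By scale invariance of dr/r the bound does not depend on A. This uniformity is what the Schur
test needs, in each of its two variables. -/
theorem lintegral_Ioi_min_rpow_le (hδ : 0 < δ) {A : ℝ} (hA : 0 < A) :
    ∫⁻ r in Ioi (0 : ℝ), ENNReal.ofReal (min (r ^ δ * A) (r ^ (-δ) * A⁻¹) / r) ≤
      ENNReal.ofReal (2 / δ) := by
  -- The point where the two branches of the minimum meet; each side contributes at most 1/δ.
  set R := A ^ (-δ⁻¹)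
  have hR : 0 < R := Real.rpow_pos_of_pos hA _
  have hRδ : R ^ δ = A⁻¹ := by
    rw [← Real.rpow_mul hA.le, neg_mul, inv_mul_cancel₀ hδ.ne', Real.rpow_neg_one]
  have hsplit : Ioi (0 : ℝ) = Ioc 0 R ∪ Ioi R := (Ioc_union_Ioi_eq_Ioi hR.le).symm
  have h1 : ∫⁻ r in Ioc 0 R, ENNReal.ofReal (min (r ^ δ * A) (r ^ (-δ) * A⁻¹) / r) ≤
      ENNReal.ofReal (1 / δ) := by
    have hint : IntervalIntegrable (fun r : ℝ => A * r ^ (δ - 1)) volume 0 R :=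
      (intervalIntegral.intervalIntegrable_rpow' (by linarith)).const_mul A
    calc _ ≤ ∫⁻ r in Ioc 0 R, ENNReal.ofReal (A * r ^ (δ - 1)) := by
          refine setLIntegral_mono' measurableSet_Ioc fun r hr => ENNReal.ofReal_le_ofReal ?_
          rw [Real.rpow_sub_one hr.1.ne', mul_div_assoc', mul_comm A]
          exact div_le_div_of_nonneg_right (min_le_left _ _) hr.1.le
      _ = ENNReal.ofReal (∫ r in Ioc 0 R, A * r ^ (δ - 1)) := by
          rw [ofReal_integral_eq_lintegral_ofReal
            ((intervalIntegrable_iff_integrableOn_Ioc_of_le hR.le).1 hint)]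
          filter_upwards [ae_restrict_mem measurableSet_Ioc] with r hr
          have := hr.1
          positivity
      _ = _ := by
          rw [← intervalIntegral.integral_of_le hR.le, intervalIntegral.integral_const_mul,
            integral_rpow (Or.inl (by linarith)), sub_add_cancel, Real.zero_rpow hδ.ne', hRδ]
          congr 1
          field_simp
          ring
  have h2 : ∫⁻ r in Ioi R, ENNReal.ofReal (min (r ^ δ * A) (r ^ (-δ) * A⁻¹) / r) ≤
      ENNReal.ofReal (1 / δ) := by
    have hint : IntegrableOn (fun r : ℝ => A⁻¹ * r ^ (-δ - 1)) (Ioi R) :=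
      (integrableOn_Ioi_rpow_of_lt (by linarith) hR).const_mul A⁻¹
    calc _ ≤ ∫⁻ r in Ioi R, ENNReal.ofReal (A⁻¹ * r ^ (-δ - 1)) := by
          refine setLIntegral_mono' measurableSet_Ioi fun r hr => ENNReal.ofReal_le_ofReal ?_
          have hr0 : 0 < r := hR.trans hr
          rw [Real.rpow_sub_one hr0.ne', mul_div_assoc', mul_comm A⁻¹]
          exact div_le_div_of_nonneg_right (min_le_right _ _) hr0.le
      _ = ENNReal.ofReal (∫ r in Ioi R, A⁻¹ * r ^ (-δ - 1)) := by
          rw [ofReal_integral_eq_lintegral_ofReal hint]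
          filter_upwards [ae_restrict_mem measurableSet_Ioi] with r hr
          have : 0 < r := hR.trans hr
          positivity
      _ = _ := by
          rw [integral_const_mul, integral_Ioi_rpow_of_lt (by linarith) hR, sub_add_cancel,
            Real.rpow_neg hR.le, hRδ]
          congr 1
          field_simp
  rw [hsplit]
  refine (lintegral_union_le _ _ _).trans ((add_le_add h1 h2).trans (le_of_eq ?_))
  rw [← ENNReal.ofReal_add (by positivity) (by positivity)]
  congr 1
  ring

end Calderon

/-- Hölder's inequality for the measure w dν, comparing its L^1 and L^q norms. -/
theorem rpow_lintegral_mul_le {Y : Type*} [MeasurableSpace Y] (ν : Measure Y) {q : ℝ} (hq : 1 < q)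
    {φ w : Y → ℝ≥0∞} (hφ : Measurable φ) (hw : Measurable w) :
    (∫⁻ y, φ y * w y ∂ν) ^ q ≤ (∫⁻ y, w y ∂ν) ^ (q - 1) * ∫⁻ y, φ y ^ q * w y ∂ν := by
  have h := eLpNorm'_le_eLpNorm'_mul_rpow_measure_univ (μ := ν.withDensity w) (f := φ)
    zero_lt_one hq.le hφ.aestronglyMeasurable
  have hq0 : 0 < q := by linarith
  simp only [eLpNorm'_eq_lintegral_enorm, enorm_eq_self, ENNReal.rpow_one, div_one] at h
  rw [withDensity_apply _ MeasurableSet.univ, Measure.restrict_univ,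
    lintegral_withDensity_eq_lintegral_mul _ hw hφ,
    lintegral_withDensity_eq_lintegral_mul _ hw (hφ.pow_const q)] at h
  have h' := ENNReal.rpow_le_rpow h hq0.le
  rw [ENNReal.mul_rpow_of_nonneg _ _ hq0.le, ← ENNReal.rpow_mul, ← ENNReal.rpow_mul,
    one_div_mul_cancel hq0.ne', ENNReal.rpow_one, sub_mul, one_div_mul_cancel hq0.ne', one_mul,
    mul_comm] at h'
  simpa [mul_comm] using h'

/-! ### Off-diagonal Marcinkiewicz interpolation for positive kernels -/

/-- The Calderón operator applied to the decreasing rearrangement of `f`. -/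
noncomputable def calderonOperator {Y : Type*} [MeasurableSpace Y] (ν : Measure Y)
    (a b δ η : ℝ) (f : Y → ℝ≥0∞) (t : ℝ≥0∞) : ℝ≥0∞ :=
  ∫⁻ r in Ioi (0 : ℝ),
    calderonKernel a b δ η t (ENNReal.ofReal r) / ENNReal.ofReal r * rearrangement ν f r

section Interpolation

variable {X Y : Type*} [MeasurableSpace X] [MeasurableSpace Y] {μ : Measure X} {ν : Measure Y}
  {a b δ η : ℝ}

theorem antitone_calderonOperator (hb : 0 ≤ b - η) (hη : 0 ≤ η) (f : Y → ℝ≥0∞) :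
    Antitone (calderonOperator ν a b δ η f) := fun _ _ h => by
  refine lintegral_mono fun r => ?_
  exact mul_le_mul_left (ENNReal.div_le_div_right (calderonKernel_antitone hb hη _ h) _) _

/-- The passage from the distribution function to f*. The kernel is written as an integral over r <
ν{f > s} and the order is exchanged. For fixed r, such s satisfy s ≤ f*(r), so they form a set of
length at most f*(r). -/
theorem lintegral_calderonKernel_distribution_le [SFinite ν] (ha : 0 < a - δ) (hδ : 0 ≤ δ)
    (ha1 : a + δ ≤ 1) {f : Y → ℝ≥0∞} {t : ℝ≥0∞} (ht : t ≠ 0) (ht' : t ≠ ⊤) :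
    ∫⁻ s in Ioi (0 : ℝ), calderonKernel a b δ η t (ν {y | ENNReal.ofReal s < f y}) ≤
      4 * calderonOperator ν a b δ η f t := by
  set k : ℝ → ℝ≥0∞ := fun r => calderonKernel a b δ η t (ENNReal.ofReal r) / ENNReal.ofReal r
  have hk : Measurable k :=
    (measurable_calderonKernel.comp (measurable_const.prodMk ENNReal.measurable_ofReal)).div
      ENNReal.measurable_ofReal
  have hdist : Measurable fun s : ℝ => ν {y | ENNReal.ofReal s < f y} := by
    refine Antitone.measurable fun s s' h => measure_mono fun y hy => ?_
    exact (ENNReal.ofReal_le_ofReal h).trans_lt hy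
  have hm : MeasurableSet {z : ℝ × ℝ | ENNReal.ofReal z.2 < ν {y | ENNReal.ofReal z.1 < f y}} :=
    measurableSet_lt (by fun_prop) (hdist.comp measurable_fst)
  calc _ ≤ ∫⁻ s in Ioi (0 : ℝ), 4 * ∫⁻ r in Ioi (0 : ℝ),
        {r : ℝ | ENNReal.ofReal r < ν {y | ENNReal.ofReal s < f y}}.indicator k r :=
        lintegral_mono fun s => calderonKernel_le_lintegral ha hδ ha1 ht ht' _
    _ = 4 * ∫⁻ s in Ioi (0 : ℝ), ∫⁻ r in Ioi (0 : ℝ),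
        {r : ℝ | ENNReal.ofReal r < ν {y | ENNReal.ofReal s < f y}}.indicator k r :=
        lintegral_const_mul' _ _ ENNReal.ofNat_ne_top
    _ = 4 * ∫⁻ r in Ioi (0 : ℝ), ∫⁻ s in Ioi (0 : ℝ),
        {r : ℝ | ENNReal.ofReal r < ν {y | ENNReal.ofReal s < f y}}.indicator k r := by
        congr 1
        exact lintegral_lintegral_swap
          ((hk.comp measurable_snd).indicator hm).aemeasurable
    _ ≤ _ := by
        refine mul_le_mul_right (lintegral_mono fun r => ?_) 4
        calc _ ≤ ∫⁻ s in Ioi (0 : ℝ),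
              {s : ℝ | ENNReal.ofReal s ≤ rearrangement ν f r}.indicator (fun _ => k r) s := by
              refine lintegral_mono fun s => ?_
              refine indicator_apply_le' (fun h => ?_) fun _ => zero_le
              rw [indicator_of_mem
                (show s ∈ {s : ℝ | ENNReal.ofReal s ≤ rearrangement ν f r} from
                  le_rearrangement_of_lt h)]
          _ ≤ _ := by
              have hm' : MeasurableSet {s : ℝ | ENNReal.ofReal s ≤ rearrangement ν f r} :=
                measurableSet_le ENNReal.measurable_ofReal measurable_const
              rw [lintegral_indicator_const hm', Measure.restrict_apply hm']
              exact mul_le_mul_right (volume_Ioi_inter_ofReal_le _) _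

/-- Estimates on sets suffice because K is positive: for fixed F, integrating K over F gives a
density k on Y, and the layer cake formula for k dν involves only the level sets of f. -/
theorem setLIntegral_kernel_le [SFinite μ] [SFinite ν] {K : X → Y → ℝ≥0∞}
    (hK : Measurable (Function.uncurry K)) {C : ℝ≥0∞} (hC : C ≠ ⊤)
    (ha : 0 < a - δ) (hδ : 0 ≤ δ) (ha1 : a + δ ≤ 1)
    (h₀ : ∀ E F, MeasurableSet E → MeasurableSet F →
      ∫⁻ x in F, ∫⁻ y in E, K x y ∂ν ∂μ ≤ C * ν E ^ (a + δ) * μ F ^ (1 - (b + η)))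
    (h₁ : ∀ E F, MeasurableSet E → MeasurableSet F →
      ∫⁻ x in F, ∫⁻ y in E, K x y ∂ν ∂μ ≤ C * ν E ^ (a - δ) * μ F ^ (1 - (b - η)))
    {f : Y → ℝ≥0∞} (hf : Measurable f) {F : Set X} (hF : MeasurableSet F) (hF0 : μ F ≠ 0)
    (hF' : μ F ≠ ⊤) :
    ∫⁻ x in F, ∫⁻ y, K x y * f y ∂ν ∂μ ≤ μ F * (4 * C * calderonOperator ν a b δ η f (μ F)) := by
  set k : Y → ℝ≥0∞ := fun y => ∫⁻ x in F, K x y ∂μ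
  have hk : Measurable k := hK.lintegral_prod_left'
  have hswap : ∀ E : Set Y, ∫⁻ x in F, ∫⁻ y in E, K x y ∂ν ∂μ = ∫⁻ y in E, k y ∂ν := fun E =>
    lintegral_lintegral_swap hK.aemeasurable
  have hpt : ∀ E, MeasurableSet E →
      ∫⁻ y in E, k y ∂ν ≤ C * μ F * calderonKernel a b δ η (μ F) (ν E) := by
    intro E hE
    rw [← hswap, calderonKernel, mul_min]
    have hpow : ∀ c d : ℝ, C * ν E ^ c * μ F ^ (1 - d) = C * μ F * (ν E ^ c * μ F ^ (-d)) := by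
      intro c d
      rw [sub_eq_add_neg, ENNReal.rpow_add _ _ hF0 hF', ENNReal.rpow_one]
      ring
    exact le_min ((h₀ E F hE hF).trans_eq (hpow _ _)) ((h₁ E F hE hF).trans_eq (hpow _ _))
  calc ∫⁻ x in F, ∫⁻ y, K x y * f y ∂ν ∂μ
      = ∫⁻ y, (∫⁻ x in F, K x y * f y ∂μ) ∂ν :=
        lintegral_lintegral_swap (hK.mul (hf.comp measurable_snd)).aemeasurable
    _ = ∫⁻ y, k y * f y ∂ν := by
        refine lintegral_congr fun y => lintegral_mul_const _ ?_
        exact hK.comp (measurable_id.prodMk measurable_const)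
    _ = ∫⁻ y, f y ∂(ν.withDensity k) := (lintegral_withDensity_eq_lintegral_mul _ hk hf).symm
    _ = ∫⁻ s in Ioi (0 : ℝ), ν.withDensity k {y | ENNReal.ofReal s < f y} :=
        lintegral_eq_lintegral_Ioi_meas_lt _ hf
    _ ≤ ∫⁻ s in Ioi (0 : ℝ), C * μ F *
          calderonKernel a b δ η (μ F) (ν {y | ENNReal.ofReal s < f y}) := by
        refine lintegral_mono fun s => ?_
        have hE : MeasurableSet {y | ENNReal.ofReal s < f y} :=
          measurableSet_lt measurable_const hf
        rw [withDensity_apply _ hE]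
        exact hpt _ hE
    _ = C * μ F * ∫⁻ s in Ioi (0 : ℝ),
          calderonKernel a b δ η (μ F) (ν {y | ENNReal.ofReal s < f y}) :=
        lintegral_const_mul' _ _ (ENNReal.mul_ne_top hC hF')
    _ ≤ C * μ F * (4 * calderonOperator ν a b δ η f (μ F)) :=
        mul_le_mul_right (lintegral_calderonKernel_distribution_le ha hδ ha1 hF0 hF') _
    _ = _ := by ring

/-- If averages of `g` over sets of measure `t` are at most `G t`, with `G` antitone, then
`‖g‖_q ≤ ‖G‖_q`. -/
theorem lintegral_rpow_le_of_setLIntegral_le [SigmaFinite μ] {g : X → ℝ≥0∞} (hg : Measurable g)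
    {G : ℝ≥0∞ → ℝ≥0∞} (hG : Antitone G)
    (h : ∀ F, MeasurableSet F → μ F ≠ 0 → μ F ≠ ⊤ → ∫⁻ x in F, g x ∂μ ≤ μ F * G (μ F))
    {q : ℝ} (hq : 0 < q) :
    ∫⁻ x, g x ^ q ∂μ ≤ ∫⁻ t in Ioi (0 : ℝ), G (ENNReal.ofReal t) ^ q := by
  have key : ∀ u t : ℝ, ENNReal.ofReal t < μ {x | ENNReal.ofReal u < g x ^ q} →
      ENNReal.ofReal u ≤ G (ENNReal.ofReal t) ^ q := by
    intro u t ht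
    have hm : MeasurableSet {x | ENNReal.ofReal u < g x ^ q} :=
      measurableSet_lt measurable_const (hg.pow_const q)
    -- The level set may have infinite measure, so the hypothesis is applied to a subset F of finite
    -- measure still above t. There g ≥ u^(1/q), hence u^(1/q) ≤ G(μ F) ≤ G(t).
    obtain ⟨F, hF, hFs, hlt, hlt'⟩ := Measure.exists_subset_measure_lt_top hm ht
    have hF0 : μ F ≠ 0 := (zero_le.trans_lt hlt).ne'
    have h1 : ENNReal.ofReal u ^ q⁻¹ * μ F ≤ μ F * G (μ F) := by
      rw [← setLIntegral_const]
      refine le_trans (setLIntegral_mono hg fun x hx => ?_) (h F hF hF0 hlt'.ne)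
      exact (ENNReal.rpow_inv_le_iff hq).2 (le_of_lt (hFs hx))
    rw [mul_comm, ENNReal.mul_le_mul_iff_right hF0 hlt'.ne] at h1
    exact (ENNReal.rpow_inv_le_iff hq).1 (h1.trans (hG hlt.le))
  have hGm : Measurable fun t : ℝ => G (ENNReal.ofReal t) ^ q :=
    (hG.measurable.comp ENNReal.measurable_ofReal).pow_const q
  have hm : MeasurableSet {z : ℝ × ℝ | ENNReal.ofReal z.1 ≤ G (ENNReal.ofReal z.2) ^ q} :=
    measurableSet_le (by fun_prop) (hGm.comp measurable_snd)
  calc ∫⁻ x, g x ^ q ∂μ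
      = ∫⁻ u in Ioi (0 : ℝ), μ {x | ENNReal.ofReal u < g x ^ q} :=
        lintegral_eq_lintegral_Ioi_meas_lt _ (hg.pow_const q)
    _ = ∫⁻ u in Ioi (0 : ℝ), ∫⁻ t in Ioi (0 : ℝ),
          {t : ℝ | ENNReal.ofReal t < μ {x | ENNReal.ofReal u < g x ^ q}}.indicator 1 t :=
        lintegral_congr fun u => (lintegral_Ioi_indicator_lt _).symm
    _ ≤ ∫⁻ u in Ioi (0 : ℝ), ∫⁻ t in Ioi (0 : ℝ),
          {z : ℝ × ℝ | ENNReal.ofReal z.1 ≤ G (ENNReal.ofReal z.2) ^ q}.indicator 1 (u, t) := by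
        refine lintegral_mono fun u => lintegral_mono fun t => ?_
        refine indicator_apply_le' (fun ht => ?_) fun _ => zero_le
        rw [indicator_of_mem
          (show (u, t) ∈ {z : ℝ × ℝ | ENNReal.ofReal z.1 ≤ G (ENNReal.ofReal z.2) ^ q} from
            key u t ht)]
        rfl
    _ = ∫⁻ t in Ioi (0 : ℝ), ∫⁻ u in Ioi (0 : ℝ),
          {z : ℝ × ℝ | ENNReal.ofReal z.1 ≤ G (ENNReal.ofReal z.2) ^ q}.indicator 1 (u, t) :=
        lintegral_lintegral_swap
          (f := fun u t => {z : ℝ × ℝ | ENNReal.ofReal z.1 ≤ G (ENNReal.ofReal z.2) ^ q}.indicator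
            1 (u, t)) (measurable_one.indicator hm).aemeasurable
    _ ≤ _ := by
        refine lintegral_mono fun t => ?_
        have hm' : MeasurableSet {u : ℝ | ENNReal.ofReal u ≤ G (ENNReal.ofReal t) ^ q} :=
          measurableSet_le (by fun_prop) measurable_const
        calc _ = ∫⁻ u in Ioi (0 : ℝ),
              {u : ℝ | ENNReal.ofReal u ≤ G (ENNReal.ofReal t) ^ q}.indicator 1 u := rfl
          _ ≤ _ := by
              rw [lintegral_indicator_one hm', Measure.restrict_apply hm']
              exact volume_Ioi_inter_ofReal_le _

/-- Splits off t^(-b) r^a; what remains depends only on the ratio r^δ / t^η, apart from the factor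
1/r. -/
theorem calderonKernel_ofReal {t r : ℝ} (ht : 0 < t) (hr : 0 < r) :
    calderonKernel a b δ η (ENNReal.ofReal t) (ENNReal.ofReal r) / ENNReal.ofReal r =
      ENNReal.ofReal (t ^ (-b)) * ENNReal.ofReal (r ^ a) *
        ENNReal.ofReal (min (r ^ δ * t ^ (-η)) (r ^ (-δ) * (t ^ (-η))⁻¹) / r) := by
  simp only [calderonKernel, ENNReal.ofReal_rpow_of_pos ht, ENNReal.ofReal_rpow_of_pos hr]
  rw [← ENNReal.ofReal_mul (by positivity), ← ENNReal.ofReal_mul (by positivity),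
    ← ENNReal.ofReal_min, ← ENNReal.ofReal_div_of_pos hr, ← ENNReal.ofReal_mul (by positivity),
    ← ENNReal.ofReal_mul (by positivity), mul_div_assoc', mul_min_of_nonneg _ _ (by positivity)]
  congr 3
  · rw [Real.rpow_add hr, neg_add, Real.rpow_add ht]
    ring
  · rw [sub_eq_add_neg, Real.rpow_add hr, neg_sub, sub_eq_add_neg, add_comm, Real.rpow_add ht,
      ← Real.rpow_neg ht.le, neg_neg]
    ring

/-- Schur's test: Hölder in r against a weight of mass at most 2/δ, then Tonelli and the t-integral,
of mass at most 2/η. The relation b q = 1 turns t^(-bq) dt into the invariant measure dt/t. -/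
theorem lintegral_calderonOperator_rpow_le (hδ : 0 < δ) (hη : 0 < η) {q : ℝ} (hq : 1 < q)
    (hb : b * q = 1) (f : Y → ℝ≥0∞) :
    ∫⁻ t in Ioi (0 : ℝ), calderonOperator ν a b δ η f (ENNReal.ofReal t) ^ q ≤
      ENNReal.ofReal (2 / δ) ^ (q - 1) * ENNReal.ofReal (2 / η) * ∫⁻ r in Ioi (0 : ℝ),
        (ENNReal.ofReal (r ^ a) * rearrangement ν f r) ^ q / ENNReal.ofReal r := by
  have hq0 : 0 < q := by linarith
  set w : ℝ → ℝ → ℝ≥0∞ := fun t r =>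
    ENNReal.ofReal (min (r ^ δ * t ^ (-η)) (r ^ (-δ) * (t ^ (-η))⁻¹) / r)
  set φ : ℝ → ℝ≥0∞ := fun r => ENNReal.ofReal (r ^ a) * rearrangement ν f r
  have hφ : Measurable φ := by
    have := measurable_rearrangement (ν := ν) f
    fun_prop
  have hw : Measurable fun z : ℝ × ℝ => w z.1 z.2 := by
    fun_prop
  have hwt : ∀ t, Measurable (w t) := fun t => hw.comp (measurable_const.prodMk measurable_id)
  have hpt : ∀ t ∈ Ioi (0 : ℝ), calderonOperator ν a b δ η f (ENNReal.ofReal t) ^ q ≤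
      ENNReal.ofReal (2 / δ) ^ (q - 1) *
        ∫⁻ r in Ioi (0 : ℝ), ENNReal.ofReal t⁻¹ * (φ r ^ q * w t r) := by
    intro t ht
    have ht : 0 < t := ht
    have h1 : calderonOperator ν a b δ η f (ENNReal.ofReal t) =
        ENNReal.ofReal (t ^ (-b)) * ∫⁻ r in Ioi (0 : ℝ), φ r * w t r := by
      rw [← lintegral_const_mul' _ _ ENNReal.ofReal_ne_top]
      refine setLIntegral_congr_fun measurableSet_Ioi fun r hr => ?_
      rw [calderonKernel_ofReal ht hr]
      ring
    rw [h1, ENNReal.mul_rpow_of_nonneg _ _ hq0.le, ENNReal.ofReal_rpow_of_pos (by positivity),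
      ← Real.rpow_mul ht.le, neg_mul, hb, Real.rpow_neg_one,
      lintegral_const_mul' _ _ ENNReal.ofReal_ne_top, ← mul_assoc,
      mul_comm (_ ^ (q - 1) : ℝ≥0∞), mul_assoc]
    refine mul_le_mul_right ((rpow_lintegral_mul_le _ hq hφ (hwt t)).trans ?_) _
    refine mul_le_mul_left (ENNReal.rpow_le_rpow ?_ (by linarith)) _
    exact lintegral_Ioi_min_rpow_le hδ (by positivity)
  refine (setLIntegral_mono' measurableSet_Ioi hpt).trans ?_
  rw [lintegral_const_mul' _ _ (ENNReal.rpow_ne_top_of_nonneg (by linarith) ENNReal.ofReal_ne_top),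
    mul_assoc]
  refine mul_le_mul_right ?_ _
  rw [lintegral_lintegral_swap (by fun_prop), ← lintegral_const_mul' _ _ ENNReal.ofReal_ne_top]
  refine setLIntegral_mono' measurableSet_Ioi fun r hr => ?_
  have hr : 0 < r := hr
  calc ∫⁻ t in Ioi (0 : ℝ), ENNReal.ofReal t⁻¹ * (φ r ^ q * w t r)
      = ∫⁻ t in Ioi (0 : ℝ), φ r ^ q / ENNReal.ofReal r * ENNReal.ofReal
          (min (t ^ η * (r ^ δ)⁻¹) (t ^ (-η) * (r ^ δ)⁻¹⁻¹) / t) := by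
        refine setLIntegral_congr_fun measurableSet_Ioi fun t ht => ?_
        have ht : 0 < t := ht
        simp only [w]
        rw [mul_left_comm, ← ENNReal.ofReal_mul (by positivity), div_eq_mul_inv (φ r ^ q),
          ← ENNReal.ofReal_inv_of_pos hr, mul_assoc, ← ENNReal.ofReal_mul (by positivity)]
        congr 2
        rw [inv_inv, Real.rpow_neg hr.le, Real.rpow_neg ht.le, inv_inv, min_comm,
          mul_comm (r ^ δ), mul_comm (r ^ δ)⁻¹]
        ring
    _ = φ r ^ q / ENNReal.ofReal r * ∫⁻ t in Ioi (0 : ℝ), ENNReal.ofReal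
          (min (t ^ η * (r ^ δ)⁻¹) (t ^ (-η) * (r ^ δ)⁻¹⁻¹) / t) :=
        lintegral_const_mul _ (by fun_prop)
    _ ≤ φ r ^ q / ENNReal.ofReal r * ENNReal.ofReal (2 / η) :=
        mul_le_mul_right (lintegral_Ioi_min_rpow_le hη (by positivity)) _
    _ = _ := mul_comm _ _

/-- Off-diagonal Marcinkiewicz interpolation between two restricted weak type estimates for an
integral operator with positive kernel. -/
theorem lintegral_kernel_rpow_le [SigmaFinite μ] [SFinite ν] {K : X → Y → ℝ≥0∞}
    (hK : Measurable (Function.uncurry K)) {C : ℝ≥0∞} (hC : C ≠ ⊤)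
    (ha : 0 < a - δ) (hδ : 0 < δ) (ha1 : a + δ ≤ 1) (hb : 0 ≤ b - η) (hη : 0 < η)
    {q : ℝ} (hq : 1 < q) (hbq : b * q = 1)
    (h₀ : ∀ E F, MeasurableSet E → MeasurableSet F →
      ∫⁻ x in F, ∫⁻ y in E, K x y ∂ν ∂μ ≤ C * ν E ^ (a + δ) * μ F ^ (1 - (b + η)))
    (h₁ : ∀ E F, MeasurableSet E → MeasurableSet F →
      ∫⁻ x in F, ∫⁻ y in E, K x y ∂ν ∂μ ≤ C * ν E ^ (a - δ) * μ F ^ (1 - (b - η))) :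
    ∃ C' : ℝ≥0∞, C' ≠ ⊤ ∧ ∀ f : Y → ℝ≥0∞, Measurable f →
      ∫⁻ x, (∫⁻ y, K x y * f y ∂ν) ^ q ∂μ ≤ C' * ∫⁻ r in Ioi (0 : ℝ),
        (ENNReal.ofReal (r ^ a) * rearrangement ν f r) ^ q / ENNReal.ofReal r := by
  have hq0 : 0 < q := by linarith
  have h4C : 4 * C ≠ ⊤ := ENNReal.mul_ne_top ENNReal.ofNat_ne_top hC
  refine ⟨(4 * C) ^ q * (ENNReal.ofReal (2 / δ) ^ (q - 1) * ENNReal.ofReal (2 / η)), ?_,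
    fun f hf => ?_⟩
  · exact ENNReal.mul_ne_top (ENNReal.rpow_ne_top_of_nonneg hq0.le h4C) (ENNReal.mul_ne_top
      (ENNReal.rpow_ne_top_of_nonneg (by linarith) ENNReal.ofReal_ne_top) ENNReal.ofReal_ne_top)
  have hg : Measurable fun x => ∫⁻ y, K x y * f y ∂ν :=
    (hK.mul (hf.comp measurable_snd)).lintegral_prod_right'
  have hG : Antitone fun t => 4 * C * calderonOperator ν a b δ η f t := fun t t' h =>
    mul_le_mul_right (antitone_calderonOperator hb hη.le f h) _
  refine (lintegral_rpow_le_of_setLIntegral_le hg hG (fun F hF hF0 hF' =>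
    setLIntegral_kernel_le hK hC ha hδ.le ha1 h₀ h₁ hf hF hF0 hF') hq0).trans ?_
  calc ∫⁻ t in Ioi (0 : ℝ), (4 * C * calderonOperator ν a b δ η f (ENNReal.ofReal t)) ^ q
      = ∫⁻ t in Ioi (0 : ℝ), (4 * C) ^ q * calderonOperator ν a b δ η f (ENNReal.ofReal t) ^ q :=
        lintegral_congr fun t => ENNReal.mul_rpow_of_nonneg _ _ hq0.le
    _ = (4 * C) ^ q * ∫⁻ t in Ioi (0 : ℝ), calderonOperator ν a b δ η f (ENNReal.ofReal t) ^ q :=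
        lintegral_const_mul' _ _ (ENNReal.rpow_ne_top_of_nonneg hq0.le h4C)
    _ ≤ _ := by
        rw [mul_assoc]
        exact mul_le_mul_right (lintegral_calderonOperator_rpow_le hδ hη hq hbq f) _

end Interpolation

open Metric Module

/-! ### Power weights on finite-dimensional spaces -/

section PowerWeights

variable {E : Type*} [NormedAddCommGroup E] [NormedSpace ℝ E] [FiniteDimensional ℝ E]
  [MeasurableSpace E] [BorelSpace E] (μ : Measure E) [μ.IsAddHaarMeasure]

theorem lintegral_eq_rpow_mul_lintegral_comp_smul {φ : E → ℝ≥0∞} (hφ : Measurable φ) {R : ℝ}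
    (hR : 0 < R) :
    ∫⁻ x, φ x ∂μ = ENNReal.ofReal (R ^ (finrank ℝ E : ℝ)) * ∫⁻ x, φ (R • x) ∂μ := by
  have hm : Measurable fun x : E => R • x := measurable_const_smul R
  rw [← lintegral_map hφ hm, Measure.map_addHaar_smul μ hR.ne', lintegral_smul_measure,
    abs_of_pos (by positivity), smul_eq_mul, ← mul_assoc, ← ENNReal.ofReal_mul (by positivity),
    Real.rpow_natCast, mul_inv_cancel₀ (by positivity), ENNReal.ofReal_one, one_mul]

theorem exists_setLIntegral_ball_rpow_le (hd : 1 ≤ finrank ℝ E) {a : ℝ} (ha : a < finrank ℝ E) :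
    ∃ C : ℝ≥0∞, C ≠ ⊤ ∧ ∀ R : ℝ, 0 < R →
      ∫⁻ x in ball (0 : E) R, ENNReal.ofReal (‖x‖ ^ (-a)) ∂μ ≤
        C * ENNReal.ofReal (R ^ ((finrank ℝ E : ℝ) - a)) := by
  refine ⟨∫⁻ x in ball (0 : E) 1, ENNReal.ofReal (‖x‖ ^ (-a)) ∂μ, ?_, fun R hR => ?_⟩
  · have hint : IntegrableOn (fun x : E => ‖x‖ ^ (-a)) (ball 0 1) μ := by
      refine integrableOn_ball_of_norm_le_rpow hd ha (C := 1) ?_ ?_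
      · refine Eventually.of_forall fun x => ?_
        rw [one_mul, Real.norm_of_nonneg (by positivity)]
      · exact (by fun_prop : Measurable fun x : E => ‖x‖ ^ (-a)).aestronglyMeasurable
    exact hint.lintegral_lt_top.ne
  · have hm : Measurable fun x : E => ENNReal.ofReal (‖x‖ ^ (-a)) := by fun_prop
    rw [← lintegral_indicator measurableSet_ball,
      lintegral_eq_rpow_mul_lintegral_comp_smul μ (hm.indicator measurableSet_ball) hR,
      ← lintegral_indicator measurableSet_ball, sub_eq_add_neg, Real.rpow_add hR,
      ENNReal.ofReal_mul (by positivity), mul_comm (lintegral _ _), mul_assoc,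
      ← lintegral_const_mul _ (hm.indicator measurableSet_ball)]
    refine mul_le_mul_right (lintegral_mono fun x => ?_) _
    refine indicator_apply_le' (fun hx => ?_) fun _ => zero_le
    have hx1 : x ∈ ball (0 : E) 1 := by
      rw [mem_ball_zero_iff, norm_smul, Real.norm_of_nonneg hR.le] at hx
      rw [mem_ball_zero_iff]
      nlinarith
    rw [indicator_of_mem hx1, norm_smul, Real.norm_of_nonneg hR.le,
      Real.mul_rpow hR.le (norm_nonneg x), ENNReal.ofReal_mul (by positivity)]

/-- Bathtub principle, up to a constant: a decreasing radial weight is integrated best over a ball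
about its centre. -/
theorem exists_setLIntegral_rpow_norm_sub_le (hd : 1 ≤ finrank ℝ E) {s : ℝ} (hs : 0 ≤ s)
    (hsd : s < finrank ℝ E) :
    ∃ C : ℝ≥0∞, C ≠ ⊤ ∧ ∀ (F : Set E) (c : E),
      ∫⁻ x in F, ENNReal.ofReal (‖x - c‖ ^ (-s)) ∂μ ≤ C * μ F ^ (1 - s / finrank ℝ E) := by
  obtain ⟨C, hC, hball⟩ := exists_setLIntegral_ball_rpow_le μ hd hsd
  have hd0 : (0 : ℝ) < finrank ℝ E := by exact_mod_cast hd
  have hexp : 0 < 1 - s / finrank ℝ E := by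
    rw [sub_pos, div_lt_one hd0]
    exact hsd
  refine ⟨C + 1, by simpa using hC, fun F c => ?_⟩
  rcases eq_or_ne (μ F) 0 with h0 | h0
  · rw [Measure.restrict_eq_zero.2 h0]
    simp
  rcases eq_or_ne (μ F) ⊤ with h1 | h1
  · rw [h1, ENNReal.top_rpow_of_pos hexp, ENNReal.mul_top (by simp)]
    exact le_top
  set v := (μ F).toReal
  have hv : 0 < v := ENNReal.toReal_pos h0 h1
  have hvF : μ F = ENNReal.ofReal v := (ENNReal.ofReal_toReal h1).symm
  -- With this radius, R^d = μ F, so the part of F outside the ball contributes at most R^(-s) μ F =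
  -- R^(d - s), the same order as the ball.
  set R := v ^ (finrank ℝ E : ℝ)⁻¹
  have hR : 0 < R := Real.rpow_pos_of_pos hv _
  have hRd : v = R ^ (finrank ℝ E : ℝ) := by
    rw [← Real.rpow_mul hv.le, inv_mul_cancel₀ hd0.ne', Real.rpow_one]
  have hnear : ∫⁻ x in ball c R, ENNReal.ofReal (‖x - c‖ ^ (-s)) ∂μ ≤
      C * ENNReal.ofReal (R ^ ((finrank ℝ E : ℝ) - s)) := by
    refine le_trans (le_of_eq ?_) (hball R hR)
    rw [← lintegral_indicator measurableSet_ball, ← lintegral_indicator measurableSet_ball,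
      ← lintegral_sub_right_eq_self
        ((ball (0 : E) R).indicator fun x => ENNReal.ofReal (‖x‖ ^ (-s))) c]
    refine lintegral_congr fun x => ?_
    have hiff : x ∈ ball c R ↔ x - c ∈ ball (0 : E) R := by
      rw [mem_ball_zero_iff, mem_ball, dist_eq_norm]
    by_cases hx : x ∈ ball c R
    · rw [indicator_of_mem hx, indicator_of_mem (hiff.1 hx)]
    · rw [indicator_of_notMem hx, indicator_of_notMem (mt hiff.2 hx)]
  have hfar : ∫⁻ x in F \ ball c R, ENNReal.ofReal (‖x - c‖ ^ (-s)) ∂μ ≤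
      ENNReal.ofReal (R ^ ((finrank ℝ E : ℝ) - s)) := by
    calc _ ≤ ∫⁻ x in F \ ball c R, ENNReal.ofReal (R ^ (-s)) ∂μ := by
          refine lintegral_mono_ae ?_
          have hsub : ∀ᵐ x ∂μ.restrict (F \ ball c R), x ∈ (ball c R)ᶜ :=
            ae_mono (Measure.restrict_mono (fun x hx => hx.2) le_rfl)
              (ae_restrict_mem measurableSet_ball.compl)
          filter_upwards [hsub] with x hx
          refine ENNReal.ofReal_le_ofReal (Real.rpow_le_rpow_of_nonpos hR ?_ (by linarith))
          rw [mem_compl_iff, mem_ball, dist_eq_norm, not_lt] at hx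
          exact hx
      _ ≤ ENNReal.ofReal (R ^ (-s)) * μ F := by
          rw [setLIntegral_const]
          exact mul_le_mul_right (measure_mono sdiff_subset) _
      _ = _ := by
          rw [hvF, ← ENNReal.ofReal_mul (by positivity), hRd, ← Real.rpow_add hR]
          ring_nf
  calc _ ≤ ∫⁻ x in ball c R ∪ F \ ball c R, ENNReal.ofReal (‖x - c‖ ^ (-s)) ∂μ :=
        lintegral_mono_set (by rw [union_sdiff_self]; exact subset_union_right)
    _ ≤ C * ENNReal.ofReal (R ^ ((finrank ℝ E : ℝ) - s)) +
          ENNReal.ofReal (R ^ ((finrank ℝ E : ℝ) - s)) :=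
        (lintegral_union_le _ _ _).trans (add_le_add hnear hfar)
    _ = (C + 1) * μ F ^ (1 - s / finrank ℝ E) := by
        rw [hvF, ENNReal.ofReal_rpow_of_pos hv, ← Real.rpow_mul hv.le, add_mul, one_mul]
        have : (finrank ℝ E : ℝ)⁻¹ * ((finrank ℝ E : ℝ) - s) = 1 - s / finrank ℝ E := by
          field_simp
        rw [this]

/-- Hölder with exponents 1/a and 1/(1 - a), the case a = 0 included. -/
theorem setLIntegral_le_rpow_measure_mul {X : Type*} [MeasurableSpace X] (μ : Measure X)
    {g : X → ℝ≥0∞} (hg : Measurable g) {a : ℝ} (ha : 0 ≤ a) (ha1 : a < 1) (F : Set X) :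
    ∫⁻ x in F, g x ∂μ ≤ μ F ^ a * (∫⁻ x in F, g x ^ (1 / (1 - a)) ∂μ) ^ (1 - a) := by
  have h := eLpNorm'_le_eLpNorm'_mul_rpow_measure_univ (μ := μ.restrict F) (f := g) (p := 1)
    (q := 1 / (1 - a)) zero_lt_one (by rw [le_div_iff₀] <;> linarith) hg.aestronglyMeasurable
  simp only [eLpNorm'_eq_lintegral_enorm, enorm_eq_self, ENNReal.rpow_one, div_one,
    one_div_one_div, sub_sub_cancel, Measure.restrict_apply_univ] at h
  rwa [mul_comm] at h

/-- After Hölder the weight has exponent c / (1 - a), which is locally integrable by the strict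
bound on c. The strict upper bounds on α and β enter the argument through this condition. -/
theorem exists_setLIntegral_inter_ball_rpow_le (hd : 1 ≤ finrank ℝ E) {a c : ℝ} (ha : 0 ≤ a)
    (ha1 : a < 1) (hc : c < finrank ℝ E * (1 - a)) :
    ∃ C : ℝ≥0∞, C ≠ ⊤ ∧ ∀ (F : Set E) (R : ℝ), 0 < R →
      ∫⁻ x in F, (ball (0 : E) R).indicator (fun x => ENNReal.ofReal (‖x‖ ^ (-c))) x ∂μ ≤
        C * μ F ^ a * ENNReal.ofReal (R ^ (finrank ℝ E * (1 - a) - c)) := by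
  have ha' : 0 < 1 - a := by linarith
  obtain ⟨C, hC, hball⟩ := exists_setLIntegral_ball_rpow_le μ hd
    (show c / (1 - a) < finrank ℝ E by rwa [div_lt_iff₀ ha'])
  refine ⟨C ^ (1 - a), ENNReal.rpow_ne_top_of_nonneg ha'.le hC, fun F R hR => ?_⟩
  have hm : Measurable fun x : E => ENNReal.ofReal (‖x‖ ^ (-c)) := by fun_prop
  refine (setLIntegral_le_rpow_measure_mul μ (hm.indicator measurableSet_ball) ha ha1 F).trans ?_
  rw [mul_comm (C ^ _), mul_assoc]
  refine mul_le_mul_right ?_ _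
  have hle : ∫⁻ x in F, (ball (0 : E) R).indicator (fun x => ENNReal.ofReal (‖x‖ ^ (-c))) x ^
      (1 / (1 - a)) ∂μ ≤ C * ENNReal.ofReal (R ^ ((finrank ℝ E : ℝ) - c / (1 - a))) := by
    refine le_trans ?_ (hball R hR)
    rw [← lintegral_indicator measurableSet_ball]
    refine (setLIntegral_le_lintegral _ _).trans (lintegral_mono fun x => ?_)
    by_cases hx : x ∈ ball (0 : E) R
    · simp only [indicator_of_mem hx]
      rw [ENNReal.ofReal_rpow_of_nonneg (by positivity) (by positivity),
        ← Real.rpow_mul (norm_nonneg x), neg_mul, mul_one_div]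
    · simp only [indicator_of_notMem hx]
      rw [ENNReal.zero_rpow_of_pos (by positivity)]
  refine (ENNReal.rpow_le_rpow hle ha'.le).trans (le_of_eq ?_)
  rw [ENNReal.mul_rpow_of_nonneg _ _ ha'.le, ENNReal.ofReal_rpow_of_pos (by positivity),
    ← Real.rpow_mul hR.le, sub_mul, div_mul_cancel₀ _ ha'.ne']

end PowerWeights

/-! ### Restricted estimates for homogeneous kernels on a half space -/

section BoundaryKernel

variable {E : Type*} [NormedAddCommGroup E]

/-- The kernel `xₙ |x - (ξ, 0)|^(-κ)` in the sup norm of `E × ℝ`. -/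
noncomputable def boundaryKernel (κ : ℝ) (x : E × ℝ) (ξ : E) : ℝ≥0∞ :=
  ENNReal.ofReal (x.2 * ‖x - (ξ, 0)‖ ^ (-κ))

theorem measurable_boundaryKernel [SecondCountableTopology E] [MeasurableSpace E]
    [BorelSpace E] (κ : ℝ) :
    Measurable (Function.uncurry (boundaryKernel (E := E) κ)) := by
  unfold boundaryKernel Function.uncurry
  fun_prop

theorem norm_sub_boundary (x : E × ℝ) (ξ : E) : ‖x - (ξ, 0)‖ = max ‖x.1 - ξ‖ |x.2| := by
  simp [Prod.norm_def]

end BoundaryKernel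

section HalfSpaceKernels

variable {E : Type*} [NormedAddCommGroup E] [NormedSpace ℝ E] [FiniteDimensional ℝ E]
  [SecondCountableTopology E] [MeasurableSpace E] [BorelSpace E] (ν : Measure E)
  [ν.IsAddHaarMeasure]

/-- The ξ-integral gives |A|^a times a power of |x|. By `he` this power is -(d + 1) b, exactly the
one whose integral over F is controlled by |F|^(1 - b). -/
theorem exists_lintegral_inner_region_le (hd : 1 ≤ finrank ℝ E) {a b α e : ℝ} (ha : 0 ≤ a)
    (ha1 : a < 1) (hb : 0 ≤ b) (hb1 : b < 1) (hα : α < finrank ℝ E * (1 - a))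
    (he : e + (finrank ℝ E * (1 - a) - α) = -((finrank ℝ E + 1) * b)) :
    ∃ C : ℝ≥0∞, C ≠ ⊤ ∧ ∀ (A : Set E) (F : Set (E × ℝ)), MeasurableSet F →
      F ⊆ {x | 0 < x.2} → ∫⁻ x in F, ∫⁻ ξ in A, ENNReal.ofReal (‖x‖ ^ e) *
        (ball (0 : E) ‖x‖).indicator (fun ξ => ENNReal.ofReal (‖ξ‖ ^ (-α))) ξ ∂ν
          ∂(ν.prod volume) ≤ C * ν A ^ a * (ν.prod volume) F ^ (1 - b) := by
  obtain ⟨C₁, hC₁, h₁⟩ := exists_setLIntegral_inter_ball_rpow_le ν hd ha ha1 hα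
  have hfin : (finrank ℝ (E × ℝ) : ℝ) = finrank ℝ E + 1 := by
    rw [finrank_prod, finrank_self]
    push_cast
    rfl
  have hdpos : (0 : ℝ) < finrank ℝ E + 1 := by positivity
  obtain ⟨C₂, hC₂, h₂⟩ := exists_setLIntegral_rpow_norm_sub_le (ν.prod (volume : Measure ℝ))
    (s := (finrank ℝ E + 1) * b) (by rw [finrank_prod, finrank_self]; omega) (by positivity)
    (by rw [hfin]; nlinarith)
  refine ⟨C₁ * C₂, ENNReal.mul_ne_top hC₁ hC₂, fun A F hF hFH => ?_⟩
  have hpt : ∀ x ∈ F, ∫⁻ ξ in A, ENNReal.ofReal (‖x‖ ^ e) *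
      (ball (0 : E) ‖x‖).indicator (fun ξ => ENNReal.ofReal (‖ξ‖ ^ (-α))) ξ ∂ν ≤
        C₁ * ν A ^ a * ENNReal.ofReal (‖x - 0‖ ^ (-((finrank ℝ E + 1) * b))) := by
    intro x hx
    have hx0 : 0 < ‖x‖ := by
      refine norm_pos_iff.2 fun h => ?_
      have h2 : 0 < x.2 := hFH hx
      rw [h] at h2
      exact lt_irrefl _ h2
    rw [lintegral_const_mul' _ _ ENNReal.ofReal_ne_top, sub_zero, ← he, Real.rpow_add hx0,
      ENNReal.ofReal_mul (by positivity)]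
    refine (mul_le_mul_right (h₁ A _ hx0) _).trans (le_of_eq ?_)
    ring
  have hm : Measurable fun x : E × ℝ =>
      ENNReal.ofReal (‖x - 0‖ ^ (-((finrank ℝ E + 1 : ℝ) * b))) := by fun_prop
  refine (setLIntegral_mono' hF hpt).trans ?_
  rw [lintegral_const_mul _ hm]
  refine (mul_le_mul_right (h₂ F 0) _).trans (le_of_eq ?_)
  rw [hfin, mul_div_cancel_left₀ _ hdpos.ne']
  ring

/-- The mirror image, integrating in x before ξ. The weight exponent is β - 1 because the factor x_n
of the kernel is bounded by |x|, which explains the + 1 in the condition on β. -/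
theorem exists_lintegral_outer_region_le (hd : 1 ≤ finrank ℝ E) {a b β e : ℝ} (ha : 0 < a)
    (ha1 : a ≤ 1) (hb : 0 < b) (hb1 : b ≤ 1) (hβ : β < (finrank ℝ E + 1) * b + 1)
    (he : e + ((finrank ℝ E + 1) * b - (β - 1)) = -(finrank ℝ E * (1 - a))) :
    ∃ C : ℝ≥0∞, C ≠ ⊤ ∧ ∀ (A : Set E) (F : Set (E × ℝ)), MeasurableSet A →
      ∫⁻ ξ in A, ∫⁻ x in F, ENNReal.ofReal (‖ξ‖ ^ e) *
        (ball (0 : E × ℝ) ‖ξ‖).indicator (fun x => ENNReal.ofReal (‖x‖ ^ (-(β - 1)))) x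
          ∂(ν.prod volume) ∂ν ≤ C * ν A ^ a * (ν.prod volume) F ^ (1 - b) := by
  have hfin : (finrank ℝ (E × ℝ) : ℝ) = finrank ℝ E + 1 := by
    rw [finrank_prod, finrank_self]
    push_cast
    rfl
  have hdpos : (0 : ℝ) < finrank ℝ E := by exact_mod_cast hd
  obtain ⟨C₁, hC₁, h₁⟩ := exists_setLIntegral_inter_ball_rpow_le (ν.prod (volume : Measure ℝ))
    (a := 1 - b) (c := β - 1) (by rw [finrank_prod, finrank_self]; omega) (by linarith)
    (by linarith) (by rw [hfin, sub_sub_cancel]; linarith)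
  obtain ⟨C₂, hC₂, h₂⟩ := exists_setLIntegral_rpow_norm_sub_le ν hd
    (s := finrank ℝ E * (1 - a)) (mul_nonneg hdpos.le (by linarith)) (by nlinarith)
  rw [hfin, sub_sub_cancel] at h₁
  refine ⟨C₁ * C₂, ENNReal.mul_ne_top hC₁ hC₂, fun A F hA => ?_⟩
  have : Nontrivial E := nontrivial_of_finrank_pos (R := ℝ) (by omega)
  have hpt : ∀ᵐ ξ ∂ν.restrict A, ∫⁻ x in F, ENNReal.ofReal (‖ξ‖ ^ e) *
      (ball (0 : E × ℝ) ‖ξ‖).indicator (fun x => ENNReal.ofReal (‖x‖ ^ (-(β - 1)))) x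
        ∂(ν.prod volume) ≤ C₁ * (ν.prod volume) F ^ (1 - b) *
          ENNReal.ofReal (‖ξ - 0‖ ^ (-(finrank ℝ E * (1 - a)))) := by
    have hne : ∀ᵐ ξ ∂ν.restrict A, ξ ≠ 0 :=
      ae_restrict_of_ae (by simp [ae_iff, measure_singleton])
    filter_upwards [hne] with ξ hξ
    have hξ0 : 0 < ‖ξ‖ := norm_pos_iff.2 hξ
    rw [lintegral_const_mul' _ _ ENNReal.ofReal_ne_top, sub_zero, ← he, Real.rpow_add hξ0,
      ENNReal.ofReal_mul (by positivity)]
    refine (mul_le_mul_right (h₁ F _ hξ0) _).trans (le_of_eq ?_)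
    ring
  have hm : Measurable fun ξ : E =>
      ENNReal.ofReal (‖ξ - 0‖ ^ (-((finrank ℝ E : ℝ) * (1 - a)))) := by fun_prop
  refine (lintegral_mono_ae hpt).trans ?_
  rw [lintegral_const_mul _ hm]
  refine (mul_le_mul_right (h₂ A 0) _).trans (le_of_eq ?_)
  rw [mul_div_cancel_left₀ _ hdpos.ne', sub_sub_cancel]
  ring

/-- Hölder reduces this to the L^s norm of the kernel in ξ, with s = m / (m - σ). By scaling, that
norm does not depend on x_n, and it is finite because κ s = m + s > m. -/
theorem exists_setLIntegral_boundaryKernel_le {σ : ℝ} (hσ : 0 ≤ σ) (hσd : σ < finrank ℝ E) :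
    ∃ C : ℝ≥0∞, C ≠ ⊤ ∧ ∀ (A : Set E) (x : E × ℝ), 0 < x.2 →
      ∫⁻ ξ in A, boundaryKernel (finrank ℝ E + 1 - σ) x ξ ∂ν ≤ C * ν A ^ (σ / finrank ℝ E) := by
  set m : ℝ := (finrank ℝ E : ℝ)
  have hm0 : 0 < m := hσ.trans_lt hσd
  set κ : ℝ := m + 1 - σ
  have hκ : 0 < κ := by simp only [κ]; linarith
  have hσm : σ / m < 1 := by rwa [div_lt_one hm0]
  set s : ℝ := 1 / (1 - σ / m)
  have hs' : 0 < 1 - σ / m := by linarith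
  have hs : 0 < s := by positivity
  have hsm : s * (m - σ) = m := by
    simp only [s]
    have : m - σ ≠ 0 := by linarith
    field_simp
  have hκs : m < κ * s := by
    have : κ * s = m + s := by simp only [κ]; linear_combination hsm
    linarith
  have hfin : ∫⁻ ξ : E, ENNReal.ofReal ((1 + ‖ξ‖) ^ (-(κ * s))) ∂ν < ⊤ :=
    finite_integral_one_add_norm hκs
  set I := ∫⁻ ξ : E, ENNReal.ofReal ((1 + ‖ξ‖) ^ (-(κ * s))) ∂ν
  refine ⟨(ENNReal.ofReal (2 ^ (κ * s)) * I) ^ (1 - σ / m), ENNReal.rpow_ne_top_of_nonneg hs'.le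
    (ENNReal.mul_ne_top ENNReal.ofReal_ne_top hfin.ne), fun A x hx => ?_⟩
  have hmeas : Measurable (boundaryKernel κ x) :=
    (measurable_boundaryKernel κ).comp (measurable_const.prodMk measurable_id)
  refine (setLIntegral_le_rpow_measure_mul ν hmeas (by positivity) hσm A).trans ?_
  rw [mul_comm]
  refine mul_le_mul_left (ENNReal.rpow_le_rpow ?_ hs'.le) _
  refine (setLIntegral_le_lintegral _ _).trans ?_
  have hφ : Measurable fun ξ : E =>
      ENNReal.ofReal (2 ^ (κ * s) * x.2 ^ s * (x.2 + ‖ξ‖) ^ (-(κ * s))) := by fun_prop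
  calc ∫⁻ ξ, boundaryKernel κ x ξ ^ s ∂ν
      ≤ ∫⁻ ξ, ENNReal.ofReal (2 ^ (κ * s) * x.2 ^ s * (x.2 + ‖ξ - x.1‖) ^ (-(κ * s))) ∂ν := by
        refine lintegral_mono fun ξ => ?_
        rw [boundaryKernel, ENNReal.ofReal_rpow_of_nonneg (by positivity) hs.le,
          Real.mul_rpow hx.le (by positivity), ← Real.rpow_mul (norm_nonneg _)]
        refine ENNReal.ofReal_le_ofReal ?_
        have hle : x.2 + ‖ξ - x.1‖ ≤ 2 * ‖x - (ξ, 0)‖ := by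
          rw [norm_sub_boundary, abs_of_pos hx, norm_sub_rev]
          linarith [le_max_left ‖x.1 - ξ‖ x.2, le_max_right ‖x.1 - ξ‖ x.2]
        have hpos : 0 < x.2 + ‖ξ - x.1‖ := by positivity
        have h1 := Real.rpow_le_rpow_of_nonpos hpos hle
          (show -(κ * s) ≤ 0 by simp only [neg_nonpos]; positivity)
        rw [Real.mul_rpow zero_le_two (norm_nonneg _), Real.rpow_neg zero_le_two] at h1
        have h2 : (0 : ℝ) < 2 ^ (κ * s) := by positivity
        have h3 := mul_le_mul_of_nonneg_left h1 h2.le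
        rw [← mul_assoc, mul_inv_cancel₀ h2.ne', one_mul] at h3
        rw [neg_mul, mul_comm (2 ^ (κ * s)), mul_assoc]
        exact mul_le_mul_of_nonneg_left h3 (by positivity)
    _ = ∫⁻ ξ, ENNReal.ofReal (2 ^ (κ * s) * x.2 ^ s * (x.2 + ‖ξ‖) ^ (-(κ * s))) ∂ν :=
        lintegral_sub_right_eq_self
          (fun ξ => ENNReal.ofReal (2 ^ (κ * s) * x.2 ^ s * (x.2 + ‖ξ‖) ^ (-(κ * s)))) x.1
    _ = ENNReal.ofReal (2 ^ (κ * s)) * I := by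
        rw [lintegral_eq_rpow_mul_lintegral_comp_smul ν hφ hx,
          ← lintegral_const_mul' _ _ ENNReal.ofReal_ne_top,
          ← lintegral_const_mul' _ _ ENNReal.ofReal_ne_top]
        refine lintegral_congr fun ξ => ?_
        rw [← ENNReal.ofReal_mul (by positivity), ← ENNReal.ofReal_mul (by positivity), norm_smul,
          Real.norm_of_nonneg hx.le, ← mul_one_add x.2, Real.mul_rpow hx.le (by positivity)]
        congr 1
        have hcancel : x.2 ^ m * x.2 ^ s * x.2 ^ (-(κ * s)) = 1 := by
          rw [← Real.rpow_add hx, ← Real.rpow_add hx]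
          have : m + s + -(κ * s) = 0 := by
            simp only [κ]
            linear_combination -hsm
          rw [this, Real.rpow_zero]
        linear_combination (2 : ℝ) ^ (κ * s) * (1 + ‖ξ‖) ^ (-(κ * s)) * hcancel

/-- Since x_n ≤ |x - ξ|, the kernel is at most |x - ξ|^(-(d - σ)), and the bathtub bound applies in
dimension d + 1. -/
theorem exists_setLIntegral_boundaryKernel_le' {σ : ℝ} (hσ : 0 ≤ σ) (hσd : σ < finrank ℝ E) :
    ∃ C : ℝ≥0∞, C ≠ ⊤ ∧ ∀ (F : Set (E × ℝ)) (ξ : E), MeasurableSet F → F ⊆ {x | 0 < x.2} →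
      ∫⁻ x in F, boundaryKernel (finrank ℝ E + 1 - σ) x ξ ∂(ν.prod volume) ≤
        C * (ν.prod volume) F ^ (1 - (finrank ℝ E - σ) / (finrank ℝ E + 1)) := by
  have hfin : (finrank ℝ (E × ℝ) : ℝ) = finrank ℝ E + 1 := by
    rw [finrank_prod, finrank_self]
    push_cast
    rfl
  obtain ⟨C, hC, h⟩ := exists_setLIntegral_rpow_norm_sub_le (ν.prod (volume : Measure ℝ))
    (s := finrank ℝ E - σ) (by rw [finrank_prod, finrank_self]; omega) (by linarith)
    (by rw [hfin]; linarith)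
  rw [hfin] at h
  refine ⟨C, hC, fun F ξ hF hFH => le_trans ?_ (h F (ξ, 0))⟩
  refine setLIntegral_mono' hF fun x hx => ENNReal.ofReal_le_ofReal ?_
  have hx2 : 0 < x.2 := hFH hx
  have hle : x.2 ≤ ‖x - (ξ, 0)‖ := by
    rw [norm_sub_boundary, abs_of_pos hx2]
    exact le_max_right _ _
  have hpos : 0 < ‖x - (ξ, 0)‖ := hx2.trans_le hle
  refine (mul_le_mul_of_nonneg_right hle (by positivity)).trans (le_of_eq ?_)
  rw [← Real.rpow_one_add' hpos.le (by linarith)]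
  congr 1
  ring

theorem exists_lintegral_boundaryKernel_le (hd : 1 ≤ finrank ℝ E) {a b : ℝ}
    (ha1 : a < 1) (hb : 0 < b) (hσ : 0 ≤ finrank ℝ E * a - (finrank ℝ E + 1) * b) :
    ∃ C : ℝ≥0∞, C ≠ ⊤ ∧ ∀ (A : Set E) (F : Set (E × ℝ)), MeasurableSet F →
      F ⊆ {x | 0 < x.2} → ∫⁻ x in F, ∫⁻ ξ in A,
        boundaryKernel (finrank ℝ E + 1 - (finrank ℝ E * a - (finrank ℝ E + 1) * b)) x ξ ∂ν
          ∂(ν.prod volume) ≤ C * ν A ^ a * (ν.prod volume) F ^ (1 - b) := by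
  have hm0 : (0 : ℝ) < finrank ℝ E := by exact_mod_cast hd
  set m : ℝ := (finrank ℝ E : ℝ)
  set σ := m * a - (m + 1) * b
  have hσm : σ < m := by
    simp only [σ]
    nlinarith
  obtain ⟨C₁, hC₁, h₁⟩ := exists_setLIntegral_boundaryKernel_le ν hσ hσm
  obtain ⟨C₂, hC₂, h₂⟩ := exists_setLIntegral_boundaryKernel_le' ν hσ hσm
  -- The two bounds sit at (σ/m, 0) and (1, (m - σ)/(m + 1)), the ends of a segment of the line m a
  -- - (m + 1) b = σ. The weight θ places (a, b) between them.
  set θ := m * (1 - a) / (m - σ)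
  have hmσ : 0 < m - σ := by linarith
  have hθ : 0 ≤ θ := div_nonneg (mul_nonneg hm0.le (by linarith)) hmσ.le
  have hθ' : 1 - θ = (m + 1) * b / (m - σ) := by
    simp only [θ]
    field_simp
    simp only [σ]
    ring
  have hθ1 : 0 ≤ 1 - θ := by rw [hθ']; positivity
  refine ⟨C₁ ^ θ * C₂ ^ (1 - θ), ENNReal.mul_ne_top (ENNReal.rpow_ne_top_of_nonneg hθ hC₁)
    (ENNReal.rpow_ne_top_of_nonneg hθ1 hC₂), fun A F hF hFH => ?_⟩
  set I := ∫⁻ x in F, ∫⁻ ξ in A, boundaryKernel (m + 1 - σ) x ξ ∂ν ∂(ν.prod volume)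
  have hI₁ : I ≤ C₁ * ν A ^ (σ / m) * (ν.prod volume) F := by
    refine (setLIntegral_mono' hF fun x hx => h₁ A x (hFH hx)).trans ?_
    rw [setLIntegral_const]
  have hI₂ : I ≤ C₂ * (ν.prod volume) F ^ (1 - (m - σ) / (m + 1)) * ν A := by
    have hswap : I = ∫⁻ ξ in A, ∫⁻ x in F, boundaryKernel (m + 1 - σ) x ξ ∂(ν.prod volume) ∂ν :=
      lintegral_lintegral_swap (measurable_boundaryKernel _).aemeasurable
    rw [hswap, ← setLIntegral_const]
    exact lintegral_mono fun ξ => h₂ F ξ hF hFH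
  have hexp2 : 0 ≤ 1 - (m - σ) / (m + 1) := by
    rw [sub_nonneg, div_le_one (by linarith)]
    linarith
  calc I = I ^ θ * I ^ (1 - θ) := by
        rw [← ENNReal.rpow_add_of_nonneg _ _ hθ hθ1, add_sub_cancel, ENNReal.rpow_one]
    _ ≤ (C₁ * ν A ^ (σ / m) * (ν.prod volume) F) ^ θ *
          (C₂ * (ν.prod volume) F ^ (1 - (m - σ) / (m + 1)) * ν A) ^ (1 - θ) :=
        mul_le_mul' (ENNReal.rpow_le_rpow hI₁ hθ) (ENNReal.rpow_le_rpow hI₂ hθ1)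
    _ = C₁ ^ θ * C₂ ^ (1 - θ) * (ν A ^ (σ / m * θ) * ν A ^ (1 - θ)) *
          ((ν.prod volume) F ^ θ * (ν.prod volume) F ^ ((1 - (m - σ) / (m + 1)) * (1 - θ))) := by
        rw [ENNReal.mul_rpow_of_nonneg _ _ hθ, ENNReal.mul_rpow_of_nonneg _ _ hθ,
          ENNReal.mul_rpow_of_nonneg _ _ hθ1, ENNReal.mul_rpow_of_nonneg _ _ hθ1,
          ← ENNReal.rpow_mul, ← ENNReal.rpow_mul]
        ring
    _ = _ := by
        rw [← ENNReal.rpow_add_of_nonneg _ _ (by positivity) hθ1,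
          ← ENNReal.rpow_add_of_nonneg _ _ hθ (by positivity)]
        have e1 : σ / m * θ + (1 - θ) = a := by
          have : θ * (m - σ) = m * (1 - a) := div_mul_cancel₀ _ hmσ.ne'
          field_simp
          linear_combination -this
        have e2 : θ + (1 - (m - σ) / (m + 1)) * (1 - θ) = 1 - b := by
          have : (1 - θ) * (m - σ) = (m + 1) * b := by rw [hθ', div_mul_cancel₀ _ hmσ.ne']
          field_simp
          linear_combination -this
        rw [e1, e2]

end HalfSpaceKernels

/-! ### Pointwise bounds for the weighted kernel -/

theorem rpow_le_two_rpow_abs_mul {u v : ℝ} (hu : 0 < u) (hv : 0 < v) (huv : u ≤ 2 * v)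
    (hvu : v ≤ 2 * u) (r : ℝ) : u ^ r ≤ 2 ^ |r| * v ^ r := by
  rcases le_total 0 r with hr | hr
  · rw [abs_of_nonneg hr, ← Real.mul_rpow zero_le_two hv.le]
    exact Real.rpow_le_rpow hu.le huv hr
  · have h := Real.rpow_le_rpow_of_nonpos hv hvu hr
    rw [Real.mul_rpow zero_le_two hu.le] at h
    rw [abs_of_nonpos hr, Real.rpow_neg zero_le_two]
    have h2 : (0 : ℝ) < 2 ^ r := by positivity
    rw [inv_mul_eq_div, le_div_iff₀ h2, mul_comm]
    exact h

section Pointwise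

variable {E : Type*} [NormedAddCommGroup E]

/-- The double weighted kernel with the sup norm of `E × ℝ` in place of the Euclidean one. -/
noncomputable def supKernel (α β N : ℝ) (x : E × ℝ) (ξ : E) : ℝ :=
  ‖ξ‖ ^ (-α) * (x.2 * ‖x - (ξ, 0)‖ ^ (-N)) * ‖x‖ ^ (-β)

theorem snd_le_norm (x : E × ℝ) : x.2 ≤ ‖x‖ := (le_abs_self _).trans (norm_snd_le x)

theorem norm_boundary (ξ : E) : ‖((ξ, 0) : E × ℝ)‖ = ‖ξ‖ := by
  simp [Prod.norm_def]

theorem rpow_neg_le_of_half_le {u v N : ℝ} (hv : 0 < v) (h : v ≤ 2 * u) (hN : 0 ≤ N) :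
    u ^ (-N) ≤ 2 ^ N * v ^ (-N) := by
  have hu : 0 < u := by linarith
  have h1 := Real.rpow_le_rpow_of_nonpos hv h (neg_nonpos.2 hN)
  rw [Real.mul_rpow zero_le_two hu.le, Real.rpow_neg zero_le_two] at h1
  rwa [inv_mul_le_iff₀ (by positivity)] at h1

theorem supKernel_le_inner {α β N : ℝ} (hN : 0 ≤ N) {x : E × ℝ} {ξ : E} (hx : 0 < x.2)
    (h : 2 * ‖ξ‖ ≤ ‖x‖) :
    supKernel α β N x ξ ≤ 2 ^ N * (‖x‖ ^ (1 - β - N) * ‖ξ‖ ^ (-α)) := by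
  have hx0 : 0 < ‖x‖ := hx.trans_le (snd_le_norm x)
  have hD : ‖x‖ ≤ 2 * ‖x - (ξ, 0)‖ := by
    have := norm_sub_norm_le x (ξ, 0)
    rw [norm_boundary] at this
    linarith
  have h1 : x.2 * ‖x - (ξ, 0)‖ ^ (-N) ≤ ‖x‖ * (2 ^ N * ‖x‖ ^ (-N)) :=
    mul_le_mul (snd_le_norm x) (rpow_neg_le_of_half_le hx0 hD hN) (by positivity) hx0.le
  have h2 : ‖x‖ ^ (1 - β - N) = ‖x‖ * ‖x‖ ^ (-N) * ‖x‖ ^ (-β) := by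
    rw [sub_right_comm, sub_eq_add_neg _ β, Real.rpow_add hx0, sub_eq_add_neg, Real.rpow_add hx0, Real.rpow_one]
  calc supKernel α β N x ξ ≤ ‖ξ‖ ^ (-α) * (‖x‖ * (2 ^ N * ‖x‖ ^ (-N))) * ‖x‖ ^ (-β) := by
        unfold supKernel
        gcongr
    _ = _ := by rw [h2]; ring

theorem supKernel_le_outer {α β N : ℝ} (hN : 0 ≤ N) {x : E × ℝ} {ξ : E} (hx : 0 < x.2)
    (h : 2 * ‖x‖ ≤ ‖ξ‖) :
    supKernel α β N x ξ ≤ 2 ^ N * (‖ξ‖ ^ (-α - N) * ‖x‖ ^ (-(β - 1))) := by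
  have hx0 : 0 < ‖x‖ := hx.trans_le (snd_le_norm x)
  have hξ0 : 0 < ‖ξ‖ := by linarith
  have hD : ‖ξ‖ ≤ 2 * ‖x - (ξ, 0)‖ := by
    have := norm_sub_norm_le (ξ, 0) x
    rw [norm_boundary, norm_sub_rev] at this
    linarith
  have h1 : x.2 * ‖x - (ξ, 0)‖ ^ (-N) ≤ ‖x‖ * (2 ^ N * ‖ξ‖ ^ (-N)) :=
    mul_le_mul (snd_le_norm x) (rpow_neg_le_of_half_le hξ0 hD hN) (by positivity) hx0.le
  have h2 : ‖x‖ ^ (-(β - 1)) = ‖x‖ * ‖x‖ ^ (-β) := by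
    rw [neg_sub, sub_eq_add_neg, Real.rpow_add hx0, Real.rpow_one]
  calc supKernel α β N x ξ ≤ ‖ξ‖ ^ (-α) * (‖x‖ * (2 ^ N * ‖ξ‖ ^ (-N))) * ‖x‖ ^ (-β) := by
        unfold supKernel
        gcongr
    _ = _ := by rw [h2, sub_eq_add_neg, Real.rpow_add hξ0]; ring

/-- Here |x| and |ξ| are comparable, so the weights combine to |ξ|^(-(α + β)). As |x - ξ| ≤ 3 |ξ|
and α + β ≥ 0, this is at most a constant times |x - ξ|^(-(α + β)). -/
theorem supKernel_le_middle {α β N : ℝ} (hαβ : 0 ≤ α + β) {x : E × ℝ} {ξ : E} (hx : 0 < x.2)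
    (h : ‖x‖ ≤ 2 * ‖ξ‖) (h' : ‖ξ‖ ≤ 2 * ‖x‖) :
    supKernel α β N x ξ ≤
      2 ^ |β| * 3 ^ (α + β) * (x.2 * ‖x - (ξ, 0)‖ ^ (-(N + α + β))) := by
  have hx0 : 0 < ‖x‖ := hx.trans_le (snd_le_norm x)
  have hξ0 : 0 < ‖ξ‖ := by linarith
  have hD0 : 0 < ‖x - (ξ, 0)‖ := by
    refine hx.trans_le ((snd_le_norm (x - (ξ, 0))).trans' ?_)
    simp
  have hD : ‖x - (ξ, 0)‖ ≤ 3 * ‖ξ‖ := by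
    have := norm_sub_le x (ξ, 0)
    rw [norm_boundary] at this
    linarith
  have h1 : ‖x‖ ^ (-β) ≤ 2 ^ |β| * ‖ξ‖ ^ (-β) := by
    have := rpow_le_two_rpow_abs_mul hx0 hξ0 h h' (-β)
    rwa [abs_neg] at this
  have h2 : ‖ξ‖ ^ (-α) * ‖ξ‖ ^ (-β) ≤ 3 ^ (α + β) * ‖x - (ξ, 0)‖ ^ (-(α + β)) := by
    have h3 := Real.rpow_le_rpow_of_nonpos hD0 hD (neg_nonpos.2 hαβ)
    rw [Real.mul_rpow (by norm_num) hξ0.le, Real.rpow_neg (by norm_num : (0 : ℝ) ≤ 3),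
      inv_mul_le_iff₀ (by positivity)] at h3
    rwa [← Real.rpow_add hξ0, ← neg_add]
  calc supKernel α β N x ξ
      ≤ ‖ξ‖ ^ (-α) * (x.2 * ‖x - (ξ, 0)‖ ^ (-N)) * (2 ^ |β| * ‖ξ‖ ^ (-β)) := by
        unfold supKernel
        gcongr
    _ = 2 ^ |β| * (x.2 * ‖x - (ξ, 0)‖ ^ (-N)) * (‖ξ‖ ^ (-α) * ‖ξ‖ ^ (-β)) := by ring
    _ ≤ 2 ^ |β| * (x.2 * ‖x - (ξ, 0)‖ ^ (-N)) *
          (3 ^ (α + β) * ‖x - (ξ, 0)‖ ^ (-(α + β))) := by gcongr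
    _ = _ := by
        rw [show -(N + α + β) = -N + -(α + β) by ring, Real.rpow_add hD0]
        ring

theorem ofReal_supKernel_le {α β N : ℝ} (hN : 0 ≤ N) (hαβ : 0 ≤ α + β) {x : E × ℝ} (ξ : E)
    (hx : 0 < x.2) :
    ENNReal.ofReal (supKernel α β N x ξ) ≤ ENNReal.ofReal (2 ^ N + 2 ^ |β| * 3 ^ (α + β)) *
      (ENNReal.ofReal (‖x‖ ^ (1 - β - N)) *
          (ball (0 : E) ‖x‖).indicator (fun ξ => ENNReal.ofReal (‖ξ‖ ^ (-α))) ξ +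
        ENNReal.ofReal (‖ξ‖ ^ (-α - N)) *
          (ball (0 : E × ℝ) ‖ξ‖).indicator (fun x => ENNReal.ofReal (‖x‖ ^ (-(β - 1)))) x +
        boundaryKernel (N + α + β) x ξ) := by
  have hx0 : 0 < ‖x‖ := hx.trans_le (snd_le_norm x)
  have hc1 : (2 : ℝ) ^ N ≤ 2 ^ N + 2 ^ |β| * 3 ^ (α + β) := by
    have : (0 : ℝ) ≤ 2 ^ |β| * 3 ^ (α + β) := by positivity
    linarith
  have hc2 : (2 : ℝ) ^ |β| * 3 ^ (α + β) ≤ 2 ^ N + 2 ^ |β| * 3 ^ (α + β) := by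
    have : (0 : ℝ) ≤ 2 ^ N := by positivity
    linarith
  have hc0 : (0 : ℝ) ≤ 2 ^ N + 2 ^ |β| * 3 ^ (α + β) := by positivity
  rcases le_total (2 * ‖ξ‖) ‖x‖ with h | h
  · rw [add_assoc, mul_add]
    refine le_add_of_le_of_nonneg ?_ zero_le
    rw [indicator_of_mem (mem_ball_zero_iff.2 (by linarith [norm_nonneg ξ])),
      ← ENNReal.ofReal_mul (by positivity), ← ENNReal.ofReal_mul hc0]
    refine ENNReal.ofReal_le_ofReal ((supKernel_le_inner hN hx h).trans ?_)
    exact mul_le_mul_of_nonneg_right hc1 (by positivity)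
  rcases le_total (2 * ‖x‖) ‖ξ‖ with h' | h'
  · rw [add_right_comm, mul_add]
    refine le_add_of_nonneg_of_le zero_le ?_
    rw [indicator_of_mem (mem_ball_zero_iff.2 (by linarith)),
      ← ENNReal.ofReal_mul (by positivity), ← ENNReal.ofReal_mul hc0]
    refine ENNReal.ofReal_le_ofReal ((supKernel_le_outer hN hx h').trans ?_)
    exact mul_le_mul_of_nonneg_right hc1 (by positivity)
  · rw [mul_add]
    refine le_add_of_nonneg_of_le zero_le ?_
    rw [boundaryKernel, ← ENNReal.ofReal_mul hc0]
    refine ENNReal.ofReal_le_ofReal ((supKernel_le_middle hαβ hx h h').trans ?_)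
    exact mul_le_mul_of_nonneg_right hc2 (by positivity)

end Pointwise

/-- Restricted estimate for the double weighted kernel. -/
theorem exists_lintegral_supKernel_le {E : Type*} [NormedAddCommGroup E] [NormedSpace ℝ E]
    [FiniteDimensional ℝ E] [SecondCountableTopology E] [MeasurableSpace E] [BorelSpace E]
    (ν : Measure E) [ν.IsAddHaarMeasure] (hd : 1 ≤ finrank ℝ E) {a b α β N : ℝ}
    (ha : 0 < a) (ha1 : a < 1) (hb : 0 < b) (hb1 : b < 1)
    (hσ : 0 ≤ finrank ℝ E * a - (finrank ℝ E + 1) * b)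
    (hα : α < finrank ℝ E * (1 - a)) (hβ : β < (finrank ℝ E + 1) * b + 1) (hαβ : 0 ≤ α + β)
    (hN : 0 ≤ N)
    (hbal : N + α + β + (finrank ℝ E * a - (finrank ℝ E + 1) * b) = finrank ℝ E + 1) :
    ∃ C : ℝ≥0∞, C ≠ ⊤ ∧ ∀ (A : Set E) (F : Set (E × ℝ)), MeasurableSet A → MeasurableSet F →
      F ⊆ {x | 0 < x.2} → ∫⁻ x in F, ∫⁻ ξ in A, ENNReal.ofReal (supKernel α β N x ξ) ∂ν
          ∂(ν.prod volume) ≤ C * ν A ^ a * (ν.prod volume) F ^ (1 - b) := by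
  obtain ⟨C₁, hC₁, h₁⟩ := exists_lintegral_inner_region_le ν hd (e := 1 - β - N) ha.le ha1 hb.le
    hb1 hα (by linarith)
  obtain ⟨C₂, hC₂, h₂⟩ := exists_lintegral_outer_region_le ν hd (e := -α - N) ha ha1.le hb hb1.le
    hβ (by linarith)
  obtain ⟨C₃, hC₃, h₃⟩ := exists_lintegral_boundaryKernel_le ν hd ha1 hb hσ
  -- The balance condition identifies the order N + α + β of the middle kernel with d + 1 - σ.
  rw [← eq_sub_iff_add_eq.2 hbal] at h₃
  set c : ℝ := 2 ^ N + 2 ^ |β| * 3 ^ (α + β)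
  refine ⟨ENNReal.ofReal c * (C₁ + C₂ + C₃), ENNReal.mul_ne_top ENNReal.ofReal_ne_top
    (by simp [hC₁, hC₂, hC₃]), fun A F hA hF hFH => ?_⟩
  set T₁ : E × ℝ → E → ℝ≥0∞ := fun x ξ => ENNReal.ofReal (‖x‖ ^ (1 - β - N)) *
    (ball (0 : E) ‖x‖).indicator (fun ξ => ENNReal.ofReal (‖ξ‖ ^ (-α))) ξ
  set T₂ : E × ℝ → E → ℝ≥0∞ := fun x ξ => ENNReal.ofReal (‖ξ‖ ^ (-α - N)) *
    (ball (0 : E × ℝ) ‖ξ‖).indicator (fun x => ENNReal.ofReal (‖x‖ ^ (-(β - 1)))) x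
  set T₃ : E × ℝ → E → ℝ≥0∞ := boundaryKernel (N + α + β)
  have hT₁ : Measurable (Function.uncurry T₁) := by
    have hs : MeasurableSet {z : (E × ℝ) × E | dist z.2 0 < ‖z.1‖} :=
      measurableSet_lt (by fun_prop) (by fun_prop)
    have hm : Measurable fun z : (E × ℝ) × E => ENNReal.ofReal (‖z.2‖ ^ (-α)) := by fun_prop
    have hm' : Measurable fun z : (E × ℝ) × E => ENNReal.ofReal (‖z.1‖ ^ (1 - β - N)) := by
      fun_prop
    exact hm'.mul (hm.indicator hs)
  have hT₂ : Measurable (Function.uncurry T₂) := by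
    have hs : MeasurableSet {z : (E × ℝ) × E | dist z.1 0 < ‖z.2‖} :=
      measurableSet_lt (by fun_prop) (by fun_prop)
    have hm : Measurable fun z : (E × ℝ) × E => ENNReal.ofReal (‖z.1‖ ^ (-(β - 1))) := by
      fun_prop
    have hm' : Measurable fun z : (E × ℝ) × E => ENNReal.ofReal (‖z.2‖ ^ (-α - N)) := by
      fun_prop
    exact hm'.mul (hm.indicator hs)
  have hsec : ∀ {T : E × ℝ → E → ℝ≥0∞}, Measurable (Function.uncurry T) →
      ∀ x, Measurable (T x) := fun hT x => hT.comp (measurable_const.prodMk measurable_id)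
  have hswap : ∫⁻ x in F, ∫⁻ ξ in A, T₂ x ξ ∂ν ∂(ν.prod volume) =
      ∫⁻ ξ in A, ∫⁻ x in F, T₂ x ξ ∂(ν.prod volume) ∂ν :=
    lintegral_lintegral_swap hT₂.aemeasurable
  calc ∫⁻ x in F, ∫⁻ ξ in A, ENNReal.ofReal (supKernel α β N x ξ) ∂ν ∂(ν.prod volume)
      ≤ ∫⁻ x in F, ENNReal.ofReal c * ∫⁻ ξ in A, (T₁ x ξ + T₂ x ξ + T₃ x ξ) ∂ν
          ∂(ν.prod volume) := by
        refine setLIntegral_mono' hF fun x hx => ?_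
        rw [← lintegral_const_mul' _ _ ENNReal.ofReal_ne_top]
        exact lintegral_mono fun ξ => ofReal_supKernel_le hN hαβ ξ (hFH hx)
    _ = ENNReal.ofReal c * ((∫⁻ x in F, ∫⁻ ξ in A, T₁ x ξ ∂ν ∂(ν.prod volume)) +
          (∫⁻ x in F, ∫⁻ ξ in A, T₂ x ξ ∂ν ∂(ν.prod volume)) +
          ∫⁻ x in F, ∫⁻ ξ in A, T₃ x ξ ∂ν ∂(ν.prod volume)) := by
        rw [lintegral_const_mul' _ _ ENNReal.ofReal_ne_top]
        congr 1
        have hI₁ : Measurable fun x => ∫⁻ ξ in A, T₁ x ξ ∂ν := hT₁.lintegral_prod_right'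
        have hI₂ : Measurable fun x => ∫⁻ ξ in A, T₂ x ξ ∂ν := hT₂.lintegral_prod_right'
        have hI : Measurable fun x => (∫⁻ ξ in A, T₁ x ξ ∂ν) + ∫⁻ ξ in A, T₂ x ξ ∂ν := hI₁.add hI₂
        rw [← lintegral_add_left hI₁, ← lintegral_add_left hI]
        refine lintegral_congr fun x => ?_
        have hT : Measurable fun ξ => T₁ x ξ + T₂ x ξ := (hsec hT₁ x).add (hsec hT₂ x)
        rw [lintegral_add_left hT, lintegral_add_left (hsec hT₁ x)]
    _ ≤ ENNReal.ofReal c * (C₁ * ν A ^ a * (ν.prod volume) F ^ (1 - b) +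
          C₂ * ν A ^ a * (ν.prod volume) F ^ (1 - b) +
          C₃ * ν A ^ a * (ν.prod volume) F ^ (1 - b)) := by
        rw [hswap]
        exact mul_le_mul_right (add_le_add (add_le_add (h₁ A F hF hFH) (h₂ A F hA))
          (h₃ A F hF hFH)) _
    _ = _ := by ring

/-! ### The double weighted fractional Poisson operator -/

section Poisson

variable {n : ℕ}

/-- The kernel `|ξ|^(-α) P(x, ξ, γ) |x|^(-β)`. -/
noncomputable def weightedKernel (α β γ : ℝ) (x : Ambient n) (ξ : Boundary n) : ℝ :=
  ‖ξ‖ ^ (-α) * poissonKernel γ x ξ * euclNorm x ^ (-β)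

theorem weightedIntegrand_eq (α β γ : ℝ) (f : Boundary n → ℝ) (x : Ambient n) (ξ : Boundary n) :
    weightedIntegrand α β γ f x ξ = weightedKernel α β γ x ξ * f ξ := by
  unfold weightedIntegrand weightedKernel
  ring

theorem measurable_weightedKernel (α β γ : ℝ) :
    Measurable (Function.uncurry (weightedKernel (n := n) α β γ)) := by
  unfold weightedKernel poissonKernel euclNorm Function.uncurry
  fun_prop

theorem weightedKernel_nonneg (α β γ : ℝ) {x : Ambient n} (hx : 0 < x.2) (ξ : Boundary n) :
    0 ≤ weightedKernel α β γ x ξ := by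
  unfold weightedKernel poissonKernel euclNorm
  positivity

theorem norm_le_euclNorm (x : Ambient n) : ‖x‖ ≤ euclNorm x := by
  rw [Prod.norm_def]
  refine max_le (Real.le_sqrt_of_sq_le (by nlinarith)) (Real.le_sqrt_of_sq_le ?_)
  rw [Real.norm_eq_abs, sq_abs]
  nlinarith [sq_nonneg ‖x.1‖]

theorem euclNorm_le (x : Ambient n) : euclNorm x ≤ 2 * ‖x‖ := by
  refine Real.sqrt_le_iff.2 ⟨by positivity, ?_⟩
  have h1 := norm_fst_le x
  have h2 := norm_snd_le x
  rw [Real.norm_eq_abs] at h2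
  have h3 : x.2 ^ 2 ≤ ‖x‖ ^ 2 := by
    rw [← sq_abs x.2]
    exact pow_le_pow_left₀ (abs_nonneg _) h2 2
  have h4 : ‖x.1‖ ^ 2 ≤ ‖x‖ ^ 2 := pow_le_pow_left₀ (norm_nonneg _) h1 2
  nlinarith [sq_nonneg ‖x‖]

theorem poissonKernel_le {γ : ℝ} (hγ : γ ≤ n + 2) {x : Ambient n} (hx : 0 < x.2)
    (ξ : Boundary n) : poissonKernel γ x ξ ≤ x.2 * ‖x - (ξ, 0)‖ ^ (-(n + 2 - γ)) := by
  have hD0 : 0 < ‖x - (ξ, 0)‖ := by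
    refine hx.trans_le ((snd_le_norm (x - (ξ, 0))).trans' ?_)
    simp
  have hle : ‖x - (ξ, 0)‖ ^ 2 ≤ ‖x.1 - ξ‖ ^ 2 + x.2 ^ 2 := by
    rw [norm_sub_boundary]
    rcases max_cases ‖x.1 - ξ‖ |x.2| with ⟨h, -⟩ | ⟨h, -⟩
    · rw [h]
      nlinarith
    · rw [h, sq_abs]
      nlinarith [sq_nonneg ‖x.1 - ξ‖]
  have h1 : ‖x - (ξ, 0)‖ ^ ((n : ℝ) + 2 - γ) ≤
      (‖x.1 - ξ‖ ^ 2 + x.2 ^ 2) ^ (((n : ℝ) + 2 - γ) / 2) := by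
    calc ‖x - (ξ, 0)‖ ^ ((n : ℝ) + 2 - γ)
        = (‖x - (ξ, 0)‖ ^ 2) ^ (((n : ℝ) + 2 - γ) / 2) := by
          rw [← Real.rpow_natCast, ← Real.rpow_mul hD0.le]
          congr 1
          push_cast
          ring
      _ ≤ _ := Real.rpow_le_rpow (by positivity) hle (by linarith)
  rw [poissonKernel, Real.rpow_neg hD0.le, div_eq_mul_inv]
  gcongr

theorem weightedKernel_le {α β γ : ℝ} (hγ : γ ≤ n + 2) {x : Ambient n} (hx : 0 < x.2)
    (ξ : Boundary n) :
    weightedKernel α β γ x ξ ≤ 2 ^ |β| * supKernel α β (n + 2 - γ) x ξ := by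
  have hx0 : 0 < ‖x‖ := hx.trans_le (snd_le_norm x)
  have hx1 : 0 < euclNorm x := hx0.trans_le (norm_le_euclNorm x)
  have h1 := rpow_le_two_rpow_abs_mul hx1 hx0 (euclNorm_le x)
    ((norm_le_euclNorm x).trans (by linarith)) (-β)
  rw [abs_neg] at h1
  calc weightedKernel α β γ x ξ
      ≤ ‖ξ‖ ^ (-α) * (x.2 * ‖x - (ξ, 0)‖ ^ (-(n + 2 - γ))) * (2 ^ |β| * ‖x‖ ^ (-β)) := by
        unfold weightedKernel
        gcongr
        exact poissonKernel_le hγ hx ξ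
    _ = _ := by
        unfold supKernel
        ring

theorem measurableSet_halfSpace : MeasurableSet (halfSpace n) :=
  measurableSet_lt measurable_const measurable_snd

/-- Restricted estimate for the double weighted Poisson kernel. -/
theorem exists_lintegral_weightedKernel_le (hn : 2 ≤ n) {a b α β γ : ℝ}
    (ha : 0 < a) (ha1 : a < 1) (hb : 0 < b) (hb1 : b < 1) (hσ : 0 ≤ ((n : ℝ) - 1) * a - n * b)
    (hα : α < ((n : ℝ) - 1) * (1 - a)) (hβ : β < n * b + 1) (hαβ : 0 ≤ α + β) (hγ : γ ≤ n + 2)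
    (hbal : ((n : ℝ) - 1) * a - n * b + α + β + 2 - γ = 0) :
    ∃ C : ℝ≥0∞, C ≠ ⊤ ∧ ∀ (A : Set (Boundary n)) (F : Set (Ambient n)), MeasurableSet A →
      MeasurableSet F → ∫⁻ x in F, (∫⁻ ξ in A, ENNReal.ofReal (weightedKernel α β γ x ξ))
        ∂(volume.restrict (halfSpace n)) ≤
          C * volume A ^ a * volume.restrict (halfSpace n) F ^ (1 - b) := by
  have hfin : (finrank ℝ (Boundary n) : ℝ) = n - 1 := by
    rw [finrank_euclideanSpace_fin, Nat.cast_sub (by omega), Nat.cast_one]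
  obtain ⟨C, hC, h⟩ := exists_lintegral_supKernel_le (volume : Measure (Boundary n))
    (a := a) (b := b) (α := α) (β := β) (N := n + 2 - γ)
    (by rw [finrank_euclideanSpace_fin]; omega) ha ha1 hb hb1 (by rw [hfin]; linarith)
    (by rwa [hfin]) (by rw [hfin]; linarith) hαβ (by linarith) (by rw [hfin]; linarith)
  refine ⟨ENNReal.ofReal (2 ^ |β|) * C, ENNReal.mul_ne_top ENNReal.ofReal_ne_top hC,
    fun A F hA hF => ?_⟩
  have hFH : MeasurableSet (F ∩ halfSpace n) := hF.inter measurableSet_halfSpace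
  rw [Measure.restrict_restrict hF, Measure.restrict_apply hF]
  calc _ ≤ ∫⁻ x in F ∩ halfSpace n, ENNReal.ofReal (2 ^ |β|) * ∫⁻ ξ in A,
        ENNReal.ofReal (supKernel α β (n + 2 - γ) x ξ) := by
        refine setLIntegral_mono' hFH fun x hx => ?_
        rw [← lintegral_const_mul' _ _ ENNReal.ofReal_ne_top]
        refine lintegral_mono fun ξ => ?_
        rw [← ENNReal.ofReal_mul (by positivity)]
        exact ENNReal.ofReal_le_ofReal (weightedKernel_le hγ hx.2 ξ)
    _ = ENNReal.ofReal (2 ^ |β|) * ∫⁻ x in F ∩ halfSpace n, ∫⁻ ξ in A,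
        ENNReal.ofReal (supKernel α β (n + 2 - γ) x ξ) :=
        lintegral_const_mul' _ _ ENNReal.ofReal_ne_top
    _ ≤ ENNReal.ofReal (2 ^ |β|) * (C * volume A ^ a * volume (F ∩ halfSpace n) ^ (1 - b)) :=
        mul_le_mul_right (h A _ hA hFH fun x hx => hx.2) _
    _ = _ := by ring

theorem lorentzNorm_rpow_eq {r s : ℝ} (hs : 0 < s) {f : Boundary n → ℝ}
    {g : Boundary n → ℝ≥0∞} (hfg : ∀ᵐ ξ, ‖f ξ‖ₑ = g ξ) :
    lorentzNorm r s f ^ s = ∫⁻ t in Ioi (0 : ℝ),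
      (ENNReal.ofReal (t ^ (1 / r)) * rearrangement volume g t) ^ s / ENNReal.ofReal t := by
  have hre : ∀ t, decreasingRearrangement f t = rearrangement volume g t := by
    intro t
    unfold decreasingRearrangement rearrangement
    congr 1
    ext s
    have : volume {ξ | s < ‖f ξ‖ₑ} = volume {ξ | s < g ξ} := by
      refine measure_congr ?_
      filter_upwards [hfg] with ξ hξ
      change (s < ‖f ξ‖ₑ) = (s < g ξ)
      rw [hξ]
    change volume _ ≤ _ ↔ volume _ ≤ _
    rw [this]
  rw [lorentzNorm, ← ENNReal.rpow_mul, one_div_mul_cancel hs.ne', ENNReal.rpow_one]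
  simp only [hre]

/-- All conditions are strict, so a small step is harmless. The direction (k, m) keeps m a - k b
fixed, which preserves the balance equation and the non-strict condition σ ≥ 0. -/
theorem exists_admissible_perturbation {a b α β m k : ℝ} (ha : 0 < a) (ha1 : a < 1) (hb : 0 < b)
    (hb1 : b < 1) (hα : α < m * (1 - a)) (hβ : β < k * b + 1) :
    ∃ ε : ℝ, 0 < ε ∧ k * ε < a ∧ a + k * ε < 1 ∧ m * ε < b ∧ b + m * ε < 1 ∧
      α < m * (1 - (a + k * ε)) ∧ β < k * (b - m * ε) + 1 := by
  have key : ∀ c d : ℝ, 0 < d → ∀ᶠ ε in 𝓝[>] (0 : ℝ), c * ε < d := by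
    intro c d hd
    have h : Tendsto (fun ε : ℝ => c * ε) (𝓝 0) (𝓝 0) := by
      have := (continuous_const_mul c).tendsto (0 : ℝ)
      rwa [mul_zero] at this
    exact (h.eventually_lt_const hd).filter_mono nhdsWithin_le_nhds
  obtain ⟨ε, h0, h1, h2, h3, h4, h5, h6⟩ :=
    ((eventually_mem_nhdsWithin (a := (0 : ℝ)) (s := Ioi 0)).and ((key k a ha).and
      ((key k (1 - a) (by linarith)).and ((key m b hb).and ((key m (1 - b) (by linarith)).and
        ((key (m * k) (m * (1 - a) - α) (by linarith)).and
          (key (k * m) (k * b + 1 - β) (by linarith)))))))).exists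
  exact ⟨ε, h0, h1, by linarith, h3, by linarith, by linarith, by linarith⟩

theorem exists_lintegral_weightedKernel_rpow_le (hn : 2 ≤ n) {p q α β γ : ℝ} (hp : 1 < p)
    (hq : 1 < q) (hσ : 0 ≤ ((n : ℝ) - 1) * (1 / p) - n * (1 / q))
    (hα : α < ((n : ℝ) - 1) * (1 - 1 / p)) (hβ : β < n * (1 / q) + 1) (hαβ : 0 ≤ α + β)
    (hγ : γ ≤ n + 2) (hbal : ((n : ℝ) - 1) * (1 / p) - n * (1 / q) + α + β + 2 - γ = 0) :
    ∃ C : ℝ≥0∞, C ≠ ⊤ ∧ ∀ g : Boundary n → ℝ≥0∞, Measurable g →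
      ∫⁻ x in halfSpace n, (∫⁻ ξ, ENNReal.ofReal (weightedKernel α β γ x ξ) * g ξ) ^ q ≤
        C * ∫⁻ t in Ioi (0 : ℝ),
          (ENNReal.ofReal (t ^ (1 / p)) * rearrangement volume g t) ^ q / ENNReal.ofReal t := by
  have hn' : (2 : ℝ) ≤ n := by exact_mod_cast hn
  have hp0 : 0 < 1 / p := by positivity
  have hp1 : 1 / p < 1 := by rw [div_lt_one] <;> linarith
  have hq0 : 0 < 1 / q := by positivity
  have hq1 : 1 / q < 1 := by rw [div_lt_one] <;> linarith
  obtain ⟨ε, hε, ha, ha1, hb, hb1, hα', hβ'⟩ :=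
    exists_admissible_perturbation hp0 hp1 hq0 hq1 hα hβ
  set a := 1 / p
  set b := 1 / q
  set δ := (n : ℝ) * ε
  set η := ((n : ℝ) - 1) * ε
  have hδ : 0 < δ := by positivity
  have hη : 0 < η := mul_pos (by linarith) hε
  have hline : ((n : ℝ) - 1) * δ = n * η := by simp only [δ, η]; ring
  have hnδ : 0 ≤ ((n : ℝ) - 1) * δ := mul_nonneg (by linarith) hδ.le
  have hnη : 0 ≤ (n : ℝ) * η := by positivity
  -- Raising (a, b) tightens only the condition on α, and lowering it only the one on β.
  obtain ⟨C₀, hC₀, h₀⟩ := exists_lintegral_weightedKernel_le hn (a := a + δ) (b := b + η)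
    (α := α) (β := β) (γ := γ) (by linarith) ha1 (by linarith) hb1 (by linarith) hα'
    (by linarith) hαβ hγ (by linarith)
  obtain ⟨C₁, hC₁, h₁⟩ := exists_lintegral_weightedKernel_le hn (a := a - δ) (b := b - η)
    (α := α) (β := β) (γ := γ) (by linarith) (by linarith) (by linarith) (by linarith)
    (by linarith) (by linarith) hβ' hαβ hγ (by linarith)
  have hK : Measurable (Function.uncurry fun (x : Ambient n) (ξ : Boundary n) =>
      ENNReal.ofReal (weightedKernel α β γ x ξ)) :=
    (measurable_weightedKernel α β γ).ennreal_ofReal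
  refine lintegral_kernel_rpow_le (μ := volume.restrict (halfSpace n)) hK
    (C := max C₀ C₁) (max_lt hC₀.lt_top hC₁.lt_top).ne
    (by linarith : 0 < a - δ) hδ ha1.le (by linarith : 0 ≤ b - η) hη hq
    (one_div_mul_cancel (by linarith)) (fun A F hA hF => (h₀ A F hA hF).trans ?_)
    (fun A F hA hF => (h₁ A F hA hF).trans ?_)
  · gcongr
    exact le_max_left _ _
  · gcongr
    exact le_max_right _ _

end Poisson

/-! ### Absolute convergence and the norm bound for `V` -/

theorem exists_eLpNorm_V_le {n : ℕ} (hn : 2 ≤ n) {p q α β γ : ℝ} (hp : 1 < p)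
    (hq : 1 < q) (hσ : 0 ≤ ((n : ℝ) - 1) * (1 / p) - n * (1 / q))
    (hα : α < ((n : ℝ) - 1) * (1 - 1 / p)) (hβ : β < n * (1 / q) + 1) (hαβ : 0 ≤ α + β)
    (hγ : γ ≤ n + 2) (hbal : ((n : ℝ) - 1) * (1 / p) - n * (1 / q) + α + β + 2 - γ = 0) :
    ∃ C : ℝ, 0 < C ∧ ∀ f : Boundary n → ℝ,
      AEStronglyMeasurable f volume → lorentzNorm p q f < ∞ →
        (∀ᵐ x ∂(volume.restrict (halfSpace n)),
          Integrable (weightedIntegrand α β γ f x) volume) ∧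
        MemLp (V α β γ f) (ENNReal.ofReal q) (volume.restrict (halfSpace n)) ∧
        eLpNorm (V α β γ f) (ENNReal.ofReal q) (volume.restrict (halfSpace n)) ≤
          ENNReal.ofReal C * lorentzNorm p q f := by
  have hq0 : 0 < q := by linarith
  have hqinv : 0 < 1 / q := by positivity
  obtain ⟨C, hC, hmain⟩ := exists_lintegral_weightedKernel_rpow_le hn hp hq hσ
    hα hβ hαβ hγ hbal
  have hCq : C ^ (1 / q) ≠ ⊤ := ENNReal.rpow_ne_top_of_nonneg hqinv.le hC
  refine ⟨(C ^ (1 / q)).toReal + 1, by positivity, fun f hf hfin => ?_⟩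
  -- The positive-kernel bound needs a measurable function, and neither the rearrangement nor the
  -- integrals see a change on a null set.
  set g : Boundary n → ℝ≥0∞ := fun ξ => ‖hf.mk f ξ‖ₑ
  have hg : Measurable g := hf.stronglyMeasurable_mk.measurable.enorm
  have hfg : ∀ᵐ ξ, ‖f ξ‖ₑ = g ξ := by
    filter_upwards [hf.ae_eq_mk] with ξ hξ
    rw [hξ]
  have hbound := hmain g hg
  rw [← lorentzNorm_rpow_eq hq0 hfg] at hbound
  set W : Ambient n → ℝ≥0∞ := fun x => ∫⁻ ξ, ENNReal.ofReal (weightedKernel α β γ x ξ) * g ξ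
  have hW : Measurable W :=
    ((measurable_weightedKernel α β γ).ennreal_ofReal.mul
      (hg.comp measurable_snd)).lintegral_prod_right'
  have hWfin : ∫⁻ x in halfSpace n, W x ^ q ≠ ⊤ :=
    ne_top_of_le_ne_top
      (ENNReal.mul_ne_top hC (ENNReal.rpow_ne_top_of_nonneg hq0.le hfin.ne)) hbound
  -- By positivity of the kernel, `W` is the integral of the absolute value. Its L^q bound thus
  -- gives absolute convergence almost everywhere and dominates |V f|.
  have hWeq : ∀ x ∈ halfSpace n, ∫⁻ ξ, ‖weightedIntegrand α β γ f x ξ‖ₑ = W x := by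
    intro x hx
    refine lintegral_congr_ae ?_
    filter_upwards [hfg] with ξ hξ
    rw [weightedIntegrand_eq, enorm_mul, hξ,
      Real.enorm_of_nonneg (weightedKernel_nonneg α β γ hx ξ)]
  have hVW : ∀ x ∈ halfSpace n, ‖V α β γ f x‖ₑ ≤ W x := fun x hx =>
    (enorm_integral_le_lintegral_enorm _).trans_eq (hWeq x hx)
  have hVm : AEStronglyMeasurable (V α β γ f) (volume.restrict (halfSpace n)) := by
    have h : AEStronglyMeasurable
        (fun z : Ambient n × Boundary n => weightedIntegrand α β γ f z.1 z.2)
        ((volume.restrict (halfSpace n)).prod volume) := by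
      simp only [weightedIntegrand_eq]
      exact (measurable_weightedKernel α β γ).aestronglyMeasurable.mul hf.comp_snd
    exact h.integral_prod_right'
  have hnorm : eLpNorm (V α β γ f) (ENNReal.ofReal q) (volume.restrict (halfSpace n)) ≤
      C ^ (1 / q) * lorentzNorm p q f := by
    rw [eLpNorm_eq_lintegral_rpow_enorm_toReal (by simpa using hq0) ENNReal.ofReal_ne_top,
      ENNReal.toReal_ofReal hq0.le]
    calc _ ≤ (C * lorentzNorm p q f ^ q) ^ (1 / q) := by
          refine ENNReal.rpow_le_rpow (le_trans ?_ hbound) hqinv.le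
          exact setLIntegral_mono' measurableSet_halfSpace fun x hx =>
            ENNReal.rpow_le_rpow (hVW x hx) hq0.le
      _ = _ := by
          rw [ENNReal.mul_rpow_of_nonneg _ _ hqinv.le, ← ENNReal.rpow_mul,
            mul_one_div_cancel hq0.ne', ENNReal.rpow_one]
  refine ⟨?_, ⟨hVm, ?_⟩, ?_⟩
  · filter_upwards [ae_lt_top (hW.pow_const q) hWfin,
      ae_restrict_mem measurableSet_halfSpace] with x hx hxH
    refine ⟨?_, ?_⟩
    · rw [show weightedIntegrand α β γ f x = fun ξ => weightedKernel α β γ x ξ * f ξ from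
        funext (weightedIntegrand_eq α β γ f x)]
      exact ((measurable_weightedKernel α β γ).comp
        (measurable_const.prodMk measurable_id)).aestronglyMeasurable.mul hf
    · rw [hasFiniteIntegral_iff_enorm, hWeq x hxH]
      exact (ENNReal.rpow_lt_top_iff_of_pos hq0).1 hx
  · exact hnorm.trans_lt (ENNReal.mul_lt_top hCq.lt_top hfin)
  · refine hnorm.trans (mul_le_mul_left ?_ _)
    rw [ENNReal.ofReal_add ENNReal.toReal_nonneg zero_le_one, ENNReal.ofReal_toReal hCq]
    exact le_self_add

end SteinWeissPoisson

theorem corollary1p3 (n : ℕ) (hn : 3 ≤ n) (p p' q q' α β γ : ℝ)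
    (hp : 1 < p) (hpp' : 1 / p + 1 / p' = 1)
    (hq' : 1 < q') (hqq' : 1 / q + 1 / q' = 1)
    (hpq : 1 ≤ ((n : ℝ) - 1) / n * (1 / p) + 1 / q')
    (hγ : 2 ≤ γ) (hγn : γ < n)
    (hα : α < ((n : ℝ) - 1) / p') (hβ : β < (n : ℝ) / q + 1) (hαβ : 0 ≤ α + β)
    (hbal : ((n : ℝ) - 1) / n * (1 / p) + 1 / q' + (α + β + 2 - γ) / n = 1) :
    ∃ C : ℝ, 0 < C ∧ ∀ f : SteinWeissPoisson.Boundary n → ℝ,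
      AEStronglyMeasurable f volume →
      SteinWeissPoisson.lorentzNorm p q f < ∞ →
        (∀ᵐ x ∂(volume.restrict (SteinWeissPoisson.halfSpace n)),
          Integrable (SteinWeissPoisson.weightedIntegrand α β γ f x) volume) ∧
        MemLp (SteinWeissPoisson.V α β γ f) (ENNReal.ofReal q)
          (volume.restrict (SteinWeissPoisson.halfSpace n)) ∧
        eLpNorm (SteinWeissPoisson.V α β γ f) (ENNReal.ofReal q)
            (volume.restrict (SteinWeissPoisson.halfSpace n)) ≤
          ENNReal.ofReal C * SteinWeissPoisson.lorentzNorm p q f := by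
  have hn' : (3 : ℝ) ≤ n := by exact_mod_cast hn
  have hn0 : (0 : ℝ) < n := by linarith
  have hq'0 : 0 < 1 / q' := by positivity
  have hq'1 : 1 / q' < 1 := by rw [div_lt_one] <;> linarith
  -- The range 1 < q < ∞ is deduced from 1/q = 1 - 1/q' with 0 < 1/q' < 1.
  have hqinv : 0 < 1 / q := by linarith
  have hq0 : 0 < q := one_div_pos.1 hqinv
  have hq : 1 < q := by
    have : 1 / q < 1 := by linarith
    rwa [div_lt_one hq0] at this
  -- Multiplied by n, and with 1/q' replaced by 1 - 1/q, the first hypothesis on the exponents is σ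
  -- ≥ 0; the balance equation is treated in the same way.
  have hpq' : 0 ≤ ((n : ℝ) - 1) * (1 / p) - n * (1 / q) := by
    have h : 1 / q ≤ ((n : ℝ) - 1) / n * (1 / p) := by linarith
    rw [div_mul_eq_mul_div, le_div_iff₀ hn0] at h
    linarith
  have hbal' : ((n : ℝ) - 1) * (1 / p) - n * (1 / q) + α + β + 2 - γ = 0 := by
    have h : ((n : ℝ) - 1) / n * (1 / p) - 1 / q + (α + β + 2 - γ) / n = 0 := by linarith
    have h' : (((n : ℝ) - 1) / n * (1 / p) - 1 / q + (α + β + 2 - γ) / n) * n = 0 := by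
      rw [h, zero_mul]
    rw [← h']
    field_simp
    ring
  have hα' : α < ((n : ℝ) - 1) * (1 - 1 / p) := by
    rw [show 1 - 1 / p = 1 / p' by linarith, mul_one_div]
    exact hα
  have hβ' : β < n * (1 / q) + 1 := by rwa [mul_one_div]
  exact SteinWeissPoisson.exists_eLpNorm_V_le (by omega) hp hq hpq' hα' hβ' hαβ (by linarith) hbal'
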